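/- Write $(a;q)_j=(1-a)(1-aq)\cdots(1-aq^{j-1})$ and $(a;q)_{-j}=1/(aq^{-j};q)_j$ for integers $j\ge 0$ (so $1/(q;q)_j=0$ for $j<0$), and let $${}_0\phi_1(-;c;q,x)=\sum_{j\ge 0}\frac{q^{j(j-1)}x^j}{(q;q)_j(c;q)_j},\qquad {}_2\phi_1(a,b;c;q,z)=\sum_{j\ge 0}\frac{(a;q)_j(b;q)_j}{(q;q)_j(c;q)_j}z^j,$$ where $0<|q|<1$ and the lower parameter $c$ is neither $1$ nor a negative integer power of $q$. Then for all integers $m,n$ there is exactly one pair $(U,V)$ of rational functions $U=U(m,n;c,x;q)$, $V=V(m,n;c,x;q)$ in $c,x,q$ (with complex coefficients) such that $${}_0\phi_1(-;cq^m;q,xq^n)=U\cdot{}_0\phi_1(-;cq;q,xq)+V\cdot{}_0\phi_1(-;c;q,x)$$ for all complex $c,x,q$ for which $0<|q|<1$, none of the lower parameters $c$, $cq$, $cq^m$ is $1$ or a negative integer power of $q$, and $U,V$ are defined. Moreover, as rational functions, $$V(m,n;c,x;q)=\frac{(1-c)(1-cq)}{x}\,U(m-1,n-1;cq,xq;q),$$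 $$U(m,n;c,x;q)=-\frac{1}{(q-c)(1-c)}\,\frac{x^{1-\max\{m,0\}}}{(x/c;q)_{\max\{n-m,0\}}}\,P^{(0,1)}(m,n;c,x;q),$$ where $P^{(0,1)}(m,n;c,x;q)$ is the following polynomial in $x$ with coefficients in $\mathbb{C}(c,q)$, of degree at most $e:=\lfloor\frac{n+1}{2}\rfloor-\min\{m,n,n-m,0\}-1$ (the zero polynomial if $e=-1$): $$P^{(0,1)}(m,n;c,x;q)=\begin{cases}\sum_{j=0}^{e}\bigl(A_{j+\min\{m,0\}}-B_{j-\max\{m,0\}}\bigr)x^j,& m\le n,\\[2pt] \sum_{j=0}^{e}\bigl(\tilde A_{j+\min\{m,0\}}-\tilde B_{j-\max\{m,0\}}\bigr)x^j,& m>n.\end{cases}$$ Here $A_j=B_j=\tilde A_j=\tilde B_j=0$ for $j<0$, and for $j\ge 0$ $$A_j=\frac{(c;q)_m\,c^{2m-n-j}q^{(j-m+1)(n-m)}}{(q;q)_j(q^2/c;q)_{j-m}}\;{}_2\phi_1(q^{-j},cq^{m-j-1};c;q,q^{2j-n+1}),$$ $$B_j=\frac{c^{-2j}q^{j(j+1)}}{(q;q)_j(q^2/c;q)_j}\;{}_2\phi_1(q^{-j},cq^{-j-1};cq^m;q,q^{n-m+1}),$$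 $$\tilde A_j=\frac{(c;q)_m\,c^{2m-n-2j}q^{(j-m+1)(j-m+n)}}{(q;q)_j(q^2/c;q)_{j-m}}\;{}_2\phi_1(q^{-j},cq^{m-j-1};c;q,q^{m-n+1}),$$ $$\tilde B_j=\frac{c^{-j}}{(q;q)_j(q^2/c;q)_j}\;{}_2\phi_1(q^{-j},cq^{-j-1};cq^m;q,q^{2j+n+1})$$ (each ${}_2\phi_1$ terminates after the term of index $j$). -/

import Mathlib

open scoped Polynomial

namespace ZeroPhiOne

/-- The `q`-shifted factorial `(a;q)_j` for an arbitrary integer `j`: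
`(a;q)_j = (1-a)(1-aq)⋯(1-aq^{j-1})` and `(a;q)_{-j} = 1/(aq^{-j};q)_j` for `j ≥ 0`. -/
def qPoch {F : Type*} [Field F] (a q : F) : ℤ → F
  | Int.ofNat j => ∏ i ∈ Finset.range j, (1 - a * q ^ i)
  | Int.negSucc j =>
      (∏ i ∈ Finset.range (j + 1), (1 - a * q ^ (-((j : ℤ) + 1)) * q ^ i))⁻¹

/-- The series `₀φ₁(–; c; q, x) = ∑_{j ≥ 0} {(-1)^j q^{j(j-1)/2}}² x^j / ((q;q)_j (c;q)_j)`
(the exponent is `1 + s - r = 2`). It converges for every `x` when `|q| < 1` and `c` is neither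
`1` nor a negative integer power of `q`. -/
noncomputable def phi01 (c q x : ℂ) : ℂ :=
  ∑' j : ℕ, ((-1) ^ j * q ^ (j.choose 2)) ^ 2 * x ^ j / (qPoch q q j * qPoch c q j)

/-- The terminating series `₂φ₁(q^{-N}, b; c; q, z)`. All its terms with `i > N` contain the
factor `(q^{-N};q)_i = 0`, so it is a finite sum. -/
def phi21 {F : Type*} [Field F] (N : ℕ) (b c q z : F) : F :=
  ∑ i ∈ Finset.range (N + 1),
    qPoch (q ^ (-(N : ℤ))) q i * qPoch b q i / (qPoch q q i * qPoch c q i) * z ^ i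

/-! The coefficients `A_j`, `B_j`, `Ã_j`, `B̃_j`, where `1/(q;q)_j = 0` for `j < 0`. -/

def coeffA {F : Type*} [Field F] (m n : ℤ) (c q : F) (j : ℤ) : F :=
  if j < 0 then 0 else
    qPoch c q m / (qPoch q q j * qPoch (q ^ 2 / c) q (j - m))
      * c ^ (2 * m - n - j) * q ^ ((j - m + 1) * (n - m))
      * phi21 j.toNat (c * q ^ (m - j - 1)) c q (q ^ (2 * j - n + 1))

def coeffB {F : Type*} [Field F] (m n : ℤ) (c q : F) (j : ℤ) : F :=
  if j < 0 then 0 else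
    1 / (qPoch q q j * qPoch (q ^ 2 / c) q j)
      * c ^ (-2 * j) * q ^ (j * (j + 1))
      * phi21 j.toNat (c * q ^ (-j - 1)) (c * q ^ m) q (q ^ (n - m + 1))

def coeffA' {F : Type*} [Field F] (m n : ℤ) (c q : F) (j : ℤ) : F :=
  if j < 0 then 0 else
    qPoch c q m / (qPoch q q j * qPoch (q ^ 2 / c) q (j - m))
      * c ^ (2 * m - n - 2 * j) * q ^ ((j - m + 1) * (j - m + n))
      * phi21 j.toNat (c * q ^ (m - j - 1)) c q (q ^ (m - n + 1))

def coeffB' {F : Type*} [Field F] (m n : ℤ) (c q : F) (j : ℤ) : F :=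
  if j < 0 then 0 else
    1 / (qPoch q q j * qPoch (q ^ 2 / c) q j)
      * c ^ (-j)
      * phi21 j.toNat (c * q ^ (-j - 1)) (c * q ^ m) q (q ^ (2 * j + n + 1))

/-- The degree bound `e = ⌊(n+1)/2⌋ - min{m, n, n-m, 0} - 1` (integer division by `2` rounds
down). -/
def degBound (m n : ℤ) : ℤ :=
  (n + 1) / 2 - min (min m n) (min (n - m) 0) - 1

/-- The polynomial `P^{(0,1)}(m, n; c, x; q)` in `x`; the sum runs over `0 ≤ j ≤ e`. -/
noncomputable def P01 {F : Type*} [Field F] (m n : ℤ) (c q : F) : F[X] :=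
  ∑ j ∈ Finset.range (degBound m n + 1).toNat,
    Polynomial.C
      (if m ≤ n then
        coeffA m n c q (j + min m 0) - coeffB m n c q (j - max m 0)
      else
        coeffA' m n c q (j + min m 0) - coeffB' m n c q (j - max m 0))
    * Polynomial.X ^ j

/-- The field `ℂ(c, x, q)` of rational functions in three variables. -/
abbrev RatCXQ : Type := FractionRing (MvPolynomial (Fin 3) ℂ)

/-- The variable `c`. -/
noncomputable def varC : RatCXQ := algebraMap (MvPolynomial (Fin 3) ℂ) RatCXQ (MvPolynomial.X (0 : Fin 3))

/-- The variable `x`. -/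
noncomputable def varX : RatCXQ := algebraMap (MvPolynomial (Fin 3) ℂ) RatCXQ (MvPolynomial.X (1 : Fin 3))

/-- The variable `q`. -/
noncomputable def varQ : RatCXQ := algebraMap (MvPolynomial (Fin 3) ℂ) RatCXQ (MvPolynomial.X (2 : Fin 3))

/-- The rational function `R` is defined at the point `(c, x, q)` and has the value `v` there. -/
def HasValueAt (R : RatCXQ) (c x q v : ℂ) : Prop :=
  ∃ N D : MvPolynomial (Fin 3) ℂ,
    MvPolynomial.eval ![c, x, q] D ≠ 0 ∧
    R = algebraMap _ RatCXQ N / algebraMap _ RatCXQ D ∧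
    v = MvPolynomial.eval ![c, x, q] N / MvPolynomial.eval ![c, x, q] D

/-- `b` is admissible as a lower parameter: neither `1` nor a negative integer power of `q`. -/
def LowerOK (b q : ℂ) : Prop := ∀ i : ℕ, b ≠ q ^ (-(i : ℤ))

/-- The rational functions `U`, `V` in `c, x, q` satisfy
`₀φ₁(–; cq^m; q, xq^n) = U · ₀φ₁(–; cq; q, xq) + V · ₀φ₁(–; c; q, x)`
wherever the three series make sense and `U`, `V` are defined. -/
def IsRecurrence (m n : ℤ) (U V : RatCXQ) : Prop :=
  ∀ c x q : ℂ, 0 < ‖q‖ → ‖q‖ < 1 →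
    LowerOK c q → LowerOK (c * q) q → LowerOK (c * q ^ m) q →
    ∀ u v : ℂ, HasValueAt U c x q u → HasValueAt V c x q v →
      phi01 (c * q ^ m) q (x * q ^ n) = u * phi01 (c * q) q (x * q) + v * phi01 c q x

/-- The substitution `(c, x, q) ↦ (cq, xq, q)` on polynomials. -/
noncomputable def shiftPoly : MvPolynomial (Fin 3) ℂ →ₐ[ℂ] MvPolynomial (Fin 3) ℂ :=
  MvPolynomial.aeval
    ![MvPolynomial.X 0 * MvPolynomial.X 2, MvPolynomial.X 1 * MvPolynomial.X 2,
      MvPolynomial.X 2]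

theorem eval_shiftPoly (p : Fin 3 → ℂ) (f : MvPolynomial (Fin 3) ℂ) :
    MvPolynomial.eval p (shiftPoly f) = MvPolynomial.eval ![p 0 * p 2, p 1 * p 2, p 2] f := by
  induction f using MvPolynomial.induction_on with
  | C a => simp [shiftPoly]
  | add f g hf hg => simp [hf, hg]
  | mul_X f i hf =>
    rw [map_mul, map_mul, map_mul, hf]
    congr 1
    fin_cases i <;> simp [shiftPoly]

theorem shiftPoly_injective : Function.Injective shiftPoly := by
  rw [injective_iff_map_eq_zero]
  intro f hf
  have h : (MvPolynomial.X 2 * f : MvPolynomial (Fin 3) ℂ) = 0 := by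
    apply MvPolynomial.funext
    intro p
    by_cases hp : p 2 = 0
    · simp [hp]
    · have h1 := eval_shiftPoly ![p 0 / p 2, p 1 / p 2, p 2] f
      have h2 : ![p 0, p 1, p 2] = p := by
        funext i
        fin_cases i <;> rfl
      simp [hf, div_mul_cancel₀ _ hp, h2] at h1
      simp [← h1]
  exact (mul_eq_zero.mp h).resolve_left (MvPolynomial.X_ne_zero 2)

/-- The substitution `R(c, x, q) ↦ R(cq, xq, q)` on rational functions. -/
noncomputable def shift : RatCXQ →+* RatCXQ :=
  IsFractionRing.map (A := MvPolynomial (Fin 3) ℂ) (B := MvPolynomial (Fin 3) ℂ)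
    (j := shiftPoly.toRingHom) shiftPoly_injective

end ZeroPhiOne

open ZeroPhiOne

/-! The functions `Y m n` = ₀φ₁(–; cq^m; q, xq^n) satisfy two contiguous relations (`IsContig`).
Over a field, when the coefficients 1 - cq^k, cq^k - xq^l, x and q are nonzero, a solution of these
relations on ℤ × ℤ is determined by its values at (0,0) and (1,1) (`IsContig.lattice_induction`,
`IsContig.ext`). Propagating along the lattice gives the existence of U and V. Uniqueness is the
linear independence of the two basic series over ℂ[x] for generic c, q: the moduli of their Taylor
coefficients interlace with ratios tending to 0 (`phi01_linearIndependent`). Uniqueness also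
transfers the contiguous relations from ₀φ₁ to U and V separately, with (U,V) = (0,1) at (0,0) and
(1,0) at (1,1).

The formula for V follows: the substitution (c,x) ↦ (cq,xq) shifts the lattice by (1,1), so both
sides solve the same relations, and only two values need comparison.

For U, Cramer's rule is applied to two solutions in Laurent series: ₀φ₁ itself and the second local
solution, built from ₀φ₁ with lower parameter q^{2-m}/c. Their Casoratian is a constant times
(x/c;q)_∞ (`casoratian`). Jackson's identity ₀φ₁(c; ct) = (t;q)_∞ · ₂φ₁(0,0;c;t) cancels this
infinite product up to (x/c;q)_{max(n-m,0)}, and the coefficients of the remaining Cauchy products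
are the terminating ₂φ₁ in A, B, Ã, B̃ (`laurentU_eq_series`). Induction on the lattice separately
bounds the poles and the degree at infinity of U (`hasPoles_laurentU`, `hasDegreeLE_laurentU`), so
the series is a polynomial of degree at most e (`laurentU_eq_P01`).

The algebra is carried out over an arbitrary field `K`, with a fresh Laurent variable. It is finally
used with `K` = ℂ(c,x,q), the Laurent variable being specialized to the element x of `K`. -/

namespace ZeroPhiOne

/-! ### q-shifted factorials with integer index, and their reversal. -/

section Pochhammer

variable {K : Type*} [Field K]

/-- `q` is nonzero and not a root of unity, and `c` is nonzero and not an integer power of `q`. -/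
structure Generic (c q : K) : Prop where
  q_ne : q ≠ 0
  q_zpow : ∀ k : ℤ, k ≠ 0 → q ^ k ≠ 1
  c_ne : c ≠ 0
  c_zpow : ∀ k : ℤ, c * q ^ k ≠ 1

namespace Generic
variable {c q : K}

theorem one_sub_ne (h : Generic c q) (k : ℤ) : 1 - c * q ^ k ≠ 0 :=
  sub_ne_zero.2 (h.c_zpow k).symm

theorem one_sub_ne' (h : Generic c q) : 1 - c ≠ 0 := by
  simpa using h.one_sub_ne 0

theorem mul_zpow (h : Generic c q) (m : ℤ) : Generic (c * q ^ m) q where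
  q_ne := h.q_ne
  q_zpow := h.q_zpow
  c_ne := mul_ne_zero h.c_ne (zpow_ne_zero _ h.q_ne)
  c_zpow k := by
    rw [mul_assoc, ← zpow_add₀ h.q_ne]; exact h.c_zpow _

theorem zpow_div (h : Generic c q) (m : ℤ) : Generic (q ^ m / c) q where
  q_ne := h.q_ne
  q_zpow := h.q_zpow
  c_ne := div_ne_zero (zpow_ne_zero _ h.q_ne) h.c_ne
  c_zpow k hk := by
    apply h.c_zpow (-(m + k))
    rw [div_mul_eq_mul_div, ← zpow_add₀ h.q_ne, div_eq_one_iff_eq h.c_ne] at hk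
    rw [← hk, ← zpow_add₀ h.q_ne]; simp

end Generic

theorem qPoch_natCast (a q : K) (j : ℕ) :
    qPoch a q (j : ℤ) = ∏ i ∈ Finset.range j, (1 - a * q ^ i) := rfl

@[simp] theorem qPoch_zero (a q : K) : qPoch a q 0 = 1 := by
  simpa using qPoch_natCast a q 0

theorem qPoch_neg_natCast (a q : K) (j : ℕ) :
    qPoch a q (-(j : ℤ)) = (∏ i ∈ Finset.range j, (1 - a * q ^ (-(j : ℤ)) * q ^ i))⁻¹ := by
  cases j with
  | zero => simp
  | succ j =>
    have : (-((j + 1 : ℕ) : ℤ)) = Int.negSucc j := by simp [Int.negSucc_eq]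
    rw [this]
    simp only [qPoch, Int.negSucc_eq]

theorem qPoch_add_one {a q : K} (hq : q ≠ 0) (h : ∀ k : ℤ, a * q ^ k ≠ 1) (k : ℤ) :
    qPoch a q (k + 1) = qPoch a q k * (1 - a * q ^ k) := by
  obtain ⟨j, rfl | rfl⟩ := k.eq_nat_or_neg
  · have : ((j : ℤ) + 1) = ((j + 1 : ℕ) : ℤ) := by simp
    rw [this, qPoch_natCast, qPoch_natCast, Finset.prod_range_succ, zpow_natCast]
  · cases j with
    | zero => simpa using qPoch_natCast a q 1
    | succ j =>
      have e : (-((j + 1 : ℕ) : ℤ) + 1) = -(j : ℤ) := by push_cast; ring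
      have h1 : (1 : K) - a * q ^ (-((j + 1 : ℕ) : ℤ)) ≠ 0 := sub_ne_zero.2 (h _).symm
      rw [e, qPoch_neg_natCast, qPoch_neg_natCast, Finset.prod_range_succ', pow_zero, mul_one,
        mul_inv, mul_assoc, inv_mul_cancel₀ h1, mul_one]
      congr 1
      refine Finset.prod_congr rfl fun i _ => ?_
      rw [mul_assoc, mul_assoc, ← zpow_natCast, ← zpow_natCast, ← zpow_add₀ hq, ← zpow_add₀ hq]
      congr 3
      push_cast; ring

theorem qPoch_ne_zero {a q : K} (hq : q ≠ 0) (h : ∀ k : ℤ, a * q ^ k ≠ 1) (k : ℤ) :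
    qPoch a q k ≠ 0 := by
  induction k using Int.induction_on with
  | zero => simp
  | succ i ih => rw [qPoch_add_one hq h]; exact mul_ne_zero ih (sub_ne_zero.2 (h _).symm)
  | pred i ih =>
    intro h0
    have := qPoch_add_one hq h (-i - 1)
    rw [h0, zero_mul, sub_add_cancel] at this
    exact ih this

theorem Generic.qPoch_ne_zero {c q : K} (h : Generic c q) (k : ℤ) : qPoch c q k ≠ 0 :=
  ZeroPhiOne.qPoch_ne_zero h.q_ne h.c_zpow k

theorem Generic.qPoch_add_one {c q : K} (h : Generic c q) (k : ℤ) :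
    qPoch c q (k + 1) = qPoch c q k * (1 - c * q ^ k) :=
  ZeroPhiOne.qPoch_add_one h.q_ne h.c_zpow k

theorem Generic.qPoch_add {c q : K} (h : Generic c q) (k l : ℤ) :
    qPoch c q (k + l) = qPoch c q k * qPoch (c * q ^ k) q l := by
  have h' := h.mul_zpow k
  have key : ∀ l : ℤ, c * q ^ k * q ^ l = c * q ^ (k + l) := fun l => by
    rw [mul_assoc, ← zpow_add₀ h.q_ne]
  induction l using Int.induction_on with
  | zero => simp
  | succ i ih =>
    rw [← add_assoc, h.qPoch_add_one, h'.qPoch_add_one, ih, key, mul_assoc]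
  | pred i ih =>
    have e1 := h.qPoch_add_one (k + (-i - 1))
    have e2 := h'.qPoch_add_one (-i - 1)
    rw [show k + (-(i : ℤ) - 1) + 1 = k + -i by ring, ih] at e1
    rw [sub_add_cancel, key] at e2
    rw [e2, ← mul_assoc] at e1
    exact (mul_right_cancel₀ (h.one_sub_ne _) e1).symm

theorem qPoch_natCast_succ (a q : K) (j : ℕ) :
    qPoch a q ((j + 1 : ℕ) : ℤ) = qPoch a q (j : ℤ) * (1 - a * q ^ j) := by
  rw [qPoch_natCast, qPoch_natCast, Finset.prod_range_succ]

theorem qPoch_natCast_succ' (a q : K) (j : ℕ) :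
    qPoch a q ((j + 1 : ℕ) : ℤ) = (1 - a) * qPoch (a * q) q (j : ℤ) := by
  rw [qPoch_natCast, qPoch_natCast, Finset.prod_range_succ', pow_zero, mul_one, mul_comm]
  simp only [pow_succ', mul_assoc]

theorem Generic.one_sub_pow_ne {c q : K} (h : Generic c q) (j : ℕ) : 1 - q ^ (j + 1) ≠ 0 := by
  have := h.q_zpow ((j + 1 : ℕ) : ℤ) (by omega)
  rw [zpow_natCast] at this
  exact sub_ne_zero.2 this.symm

theorem Generic.qPoch_self_ne_zero {c q : K} (h : Generic c q) (j : ℕ) : qPoch q q (j : ℤ) ≠ 0 := by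
  rw [qPoch_natCast, Finset.prod_ne_zero_iff]
  intro i _
  rw [← pow_succ']
  exact h.one_sub_pow_ne i

/-- Reversal of a `q`-shifted factorial. -/
theorem qPoch_reverse {a q : K} (hq : q ≠ 0) (ha : a ≠ 0) (i k : ℕ) :
    qPoch a q ((i + k : ℕ) : ℤ) * (-1) ^ i * q ^ (i.choose 2) * q ^ i =
      qPoch a q (k : ℤ) * qPoch (q ^ (1 - ((i + k : ℕ) : ℤ)) / a) q (i : ℤ)
        * a ^ i * q ^ (i * (i + k)) := by
  induction i with
  | zero => simp
  | succ i ih =>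
    have e : q ^ (1 - ((i + 1 + k : ℕ) : ℤ)) / a * q = q ^ (1 - ((i + k : ℕ) : ℤ)) / a := by
      rw [div_mul_eq_mul_div, ← zpow_add_one₀ hq]; congr 2; push_cast; ring
    have e2 : q ^ (1 - ((i + 1 + k : ℕ) : ℤ)) * q ^ (i + k) = 1 := by
      rw [← zpow_natCast, ← zpow_add₀ hq, ← zpow_zero q]; congr 1; push_cast; ring
    rw [qPoch_natCast_succ' _ _ i, e, show i + 1 + k = (i + k) + 1 by ring,
      qPoch_natCast_succ]
    rw [show i + k + 1 = i + 1 + k by ring]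
    have e3 : (1 - q ^ (1 - ((i + 1 + k : ℕ) : ℤ)) / a) * a * q ^ (i + k) = a * q ^ (i + k) - 1 := by
      have : (1 - q ^ (1 - ((i + 1 + k : ℕ) : ℤ)) / a) * a = a - q ^ (1 - ((i + 1 + k : ℕ) : ℤ)) := by
        field_simp
      rw [this, sub_mul, e2]
    have e4 : (i + 1).choose 2 = i.choose 2 + i := by
      rw [Nat.choose_succ_succ' i 1]; simp; ring
    rw [e4]
    have e5 : q ^ ((i + 1) * (i + 1 + k)) = q ^ (i * (i + k)) * q ^ (i + k) * q ^ i * q := by ring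
    rw [e5]
    set S := qPoch (q ^ (1 - ((i + k : ℕ) : ℤ)) / a) q (i : ℤ)
    set T := q ^ (1 - ((i + 1 + k : ℕ) : ℤ)) / a
    simp only [pow_succ, pow_add q (i.choose 2) i]
    linear_combination (-(1 - a * q ^ (i + k)) * q ^ i * q) * ih -
      qPoch a q (k : ℤ) * S * a ^ i * q ^ (i * (i + k)) * q ^ i * q * e3

/-- Reversing (q;q) and (a;q) together makes the signs (-1)^i cancel and merges the two powers
q^{i(i-1)/2}. This moves denominators of index k = j - i into numerator parameters, as needed to
read a Cauchy product as a ₂φ₁. -/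
theorem qPoch_reverse_mul {a c q : K} (hg : Generic c q) (ha : a ≠ 0)
    (ha' : ∀ k : ℕ, qPoch a q (k : ℤ) ≠ 0) (i k : ℕ) :
    1 / (qPoch q q (k : ℤ) * qPoch a q (k : ℤ)) =
      qPoch (q ^ (-((i + k : ℕ) : ℤ))) q (i : ℤ) * qPoch (q ^ (1 - ((i + k : ℕ) : ℤ)) / a) q (i : ℤ)
        / (qPoch q q ((i + k : ℕ) : ℤ) * qPoch a q ((i + k : ℕ) : ℤ))
        * (a ^ i * q ^ (2 * (i * k) + i * i)) := by
  have hq := hg.q_ne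
  have h1 := qPoch_reverse hq hq i k
  have h2 := qPoch_reverse hq ha i k
  have e : q ^ (1 - ((i + k : ℕ) : ℤ)) / q = q ^ (-((i + k : ℕ) : ℤ)) := by
    rw [zpow_sub₀ hq, zpow_one, zpow_neg]; field_simp
  rw [e] at h1
  have n1 := hg.qPoch_self_ne_zero k
  have n2 := hg.qPoch_self_ne_zero (i + k)
  have n3 := ha' k
  have n4 := ha' (i + k)
  have h3 := congrArg₂ (· * ·) h1 h2
  have s1 : ((-1 : K) ^ i) * (-1) ^ i = 1 := by rw [← mul_pow]; simp
  have s2 : q ^ (i.choose 2) * q ^ (i.choose 2) * q ^ i = q ^ (i * i) := by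
    rw [← pow_add, ← pow_add]
    congr 1
    have := Nat.triangle_succ i
    have h5 := Nat.choose_two_right i
    cases i with
    | zero => simp
    | succ i =>
      have h6 : (i + 1) * i % 2 = 0 := Nat.even_iff.1 (by rw [mul_comm]; exact Nat.even_mul_succ_self i)
      have h7 : (i + 1).choose 2 * 2 = (i + 1) * i := by
        rw [h5]; simp only [Nat.add_sub_cancel]; omega
      nlinarith
  rw [div_mul_eq_mul_div, div_eq_div_iff (mul_ne_zero n1 n3) (mul_ne_zero n2 n4), one_mul]
  have hz : q ^ (i * i) * q ^ i ≠ 0 := mul_ne_zero (pow_ne_zero _ hq) (pow_ne_zero _ hq)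
  apply mul_right_cancel₀ hz
  set Q1 := qPoch q q ((i + k : ℕ) : ℤ)
  set Q2 := qPoch a q ((i + k : ℕ) : ℤ)
  have e6 : q ^ (i * (i + k)) = q ^ (i * i) * q ^ (i * k) := by ring
  have e7 : q ^ (2 * (i * k) + i * i) = q ^ (i * k) * q ^ (i * k) * q ^ (i * i) := by ring
  rw [e6] at h3
  rw [e7]
  set A := q ^ (i * i)
  set B := q ^ (i * k)
  linear_combination h3 + (-Q1 * Q2 * q ^ i * q ^ (i.choose 2) * q ^ (i.choose 2) * q ^ i) * s1
    - Q1 * Q2 * q ^ i * s2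

end Pochhammer

/-! ### Formal power series: contiguity, q-difference equations, Jackson's identity, Casoratian. -/

section FormalSeries

open PowerSeries

variable {K : Type*} [Field K]

/-- The formal power series `₀φ₁(–; c; q, yX)`. -/
noncomputable def formalPhi (c q y : K) : PowerSeries K :=
  PowerSeries.mk fun j => q ^ (j * (j - 1)) * y ^ j / (qPoch q q j * qPoch c q j)

/-- The formal power series `₂φ₁(0, 0; c; q, tX)`. -/
noncomputable def formalJ (c q t : K) : PowerSeries K :=
  PowerSeries.mk fun j => t ^ j / (qPoch q q j * qPoch c q j)

/-- The formal power series `(tX; q)_∞`. -/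
noncomputable def formalE (q t : K) : PowerSeries K :=
  PowerSeries.mk fun j => (-1) ^ j * q ^ (j.choose 2) * t ^ j / qPoch q q j

theorem rescale_formalPhi (c q y r : K) :
    rescale r (formalPhi c q y) = formalPhi c q (y * r) := by
  ext j; simp only [formalPhi, coeff_rescale, coeff_mk, mul_pow]; ring

theorem rescale_formalJ (c q t r : K) : rescale r (formalJ c q t) = formalJ c q (t * r) := by
  ext j; simp only [formalJ, coeff_rescale, coeff_mk, mul_pow]; ring

theorem rescale_formalE (q t r : K) : rescale r (formalE q t) = formalE q (t * r) := by
  ext j; simp only [formalE, coeff_rescale, coeff_mk, mul_pow]; ring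

@[simp] theorem coeff_zero_formalPhi (c q y : K) : coeff 0 (formalPhi c q y) = 1 := by
  simp [formalPhi]

@[simp] theorem coeff_zero_formalJ (c q t : K) : coeff 0 (formalJ c q t) = 1 := by
  simp [formalJ]

@[simp] theorem coeff_zero_formalE (q t : K) : coeff 0 (formalE q t) = 1 := by
  simp [formalE]

theorem rescale_X (r : K) : rescale r (X : PowerSeries K) = C r * X := by
  ext j; simp only [coeff_rescale, coeff_C_mul, coeff_X]; split_ifs with h <;> simp [h]

theorem rescale_C (r a : K) : rescale r (C a : PowerSeries K) = C a := by
  ext j; simp only [coeff_rescale, coeff_C]; split_ifs with h <;> simp [h]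

@[simp] theorem constantCoeff_formalPhi (c q y : K) : constantCoeff (formalPhi c q y) = 1 := by
  rw [← coeff_zero_eq_constantCoeff_apply, coeff_zero_formalPhi]

@[simp] theorem constantCoeff_formalJ (c q t : K) : constantCoeff (formalJ c q t) = 1 := by
  rw [← coeff_zero_eq_constantCoeff_apply, coeff_zero_formalJ]

@[simp] theorem constantCoeff_formalE (q t : K) : constantCoeff (formalE q t) = 1 := by
  rw [← coeff_zero_eq_constantCoeff_apply, coeff_zero_formalE]

variable {c q : K}

theorem pow_mul_pred_succ (q : K) (j : ℕ) :
    q ^ ((j + 1) * (j + 1 - 1)) = q ^ (j * (j - 1)) * q ^ (2 * j) := by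
  rw [← pow_add]; congr 1
  cases j with
  | zero => rfl
  | succ j => simp only [Nat.add_sub_cancel]; ring

/-- The factor 1 - q^{j+1} produced by the difference cancels the last factor of (q;q)_{j+1}, which
lowers the index by one. -/
theorem formalPhi_sub (h : Generic c q) (y : K) :
    C (1 - c) * (formalPhi c q y - formalPhi c q (y * q)) =
      C y * X * formalPhi (c * q) q (y * q ^ 2) := by
  ext j
  cases j with
  | zero => simp [mul_assoc]
  | succ j =>
    have n1 := h.qPoch_self_ne_zero j
    have n2 := h.one_sub_pow_ne j
    have n3 := h.one_sub_ne'
    have n4 : qPoch (c * q) q (j : ℤ) ≠ 0 := by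
      simpa using (h.mul_zpow 1).qPoch_ne_zero j
    rw [mul_assoc, coeff_C_mul, coeff_C_mul, coeff_succ_X_mul]
    simp only [formalPhi, map_sub, coeff_mk]
    rw [qPoch_natCast_succ, qPoch_natCast_succ', pow_mul_pred_succ, ← pow_succ']
    field_simp
    ring

/-- Termwise this is (c;q)_j (1 - cq^j) = (1 - c)(cq;q)_j. -/
theorem formalPhi_contig (h : Generic c q) (y : K) :
    C (1 - c) * formalPhi c q y =
      formalPhi (c * q) q y - C c * formalPhi (c * q) q (y * q) := by
  ext j
  have n1 := h.qPoch_self_ne_zero j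
  have n3 := h.one_sub_ne'
  have n4 : qPoch (c * q) q (j : ℤ) ≠ 0 := by
    simpa using (h.mul_zpow 1).qPoch_ne_zero j
  have n5 := h.qPoch_ne_zero j
  have e : qPoch c q (j : ℤ) * (1 - c * q ^ j) = (1 - c) * qPoch (c * q) q (j : ℤ) := by
    rw [← qPoch_natCast_succ, qPoch_natCast_succ']
  rw [coeff_C_mul, map_sub, coeff_C_mul]
  simp only [formalPhi, coeff_mk]
  field_simp
  linear_combination (-(q ^ (j * (j - 1)) * y ^ j)) * e

theorem formalE_mul (h : Generic c q) (t : K) :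
    formalE q (t * q) * (1 - C t * X) = formalE q t := by
  ext j
  cases j with
  | zero => simp [mul_sub, ← mul_assoc]
  | succ j =>
    have n1 := h.qPoch_self_ne_zero j
    have n2 := h.one_sub_pow_ne j
    rw [mul_sub, mul_one, ← mul_assoc, map_sub, coeff_succ_mul_X, mul_comm _ (C t), coeff_C_mul]
    simp only [formalE, coeff_mk]
    rw [qPoch_natCast_succ, ← pow_succ', Nat.choose_succ_succ' j 1, Nat.choose_one_right]
    field_simp
    ring

/-- The equation is a first-order recursion for the coefficients whose leading factor q^{j+1} - 1
never vanishes, so the constant term determines the solution. -/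
theorem eq_C_mul_formalE (h : Generic c q) {t : K} {f : PowerSeries K}
    (hf : rescale q f * (1 - C t * X) = f) : f = C (coeff 0 f) * formalE q t := by
  have hE : rescale q (formalE q t) * (1 - C t * X) = formalE q t := by
    rw [rescale_formalE, formalE_mul h]
  have step : ∀ (g : PowerSeries K), rescale q g * (1 - C t * X) = g → ∀ j,
      (q ^ (j + 1) - 1) * coeff (j + 1) g = t * (q ^ j * coeff j g) := by
    intro g hg j
    have := congrArg (coeff (j + 1)) hg
    rw [mul_sub, mul_one, ← mul_assoc, map_sub, coeff_succ_mul_X, mul_comm _ (C t), coeff_C_mul,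
      coeff_rescale, coeff_rescale] at this
    linear_combination this
  ext j
  rw [coeff_C_mul]
  induction j with
  | zero => simp
  | succ j ih =>
    have n2 : q ^ (j + 1) - 1 ≠ 0 := by rw [← neg_sub]; exact neg_ne_zero.2 (h.one_sub_pow_ne j)
    apply mul_left_cancel₀ n2
    rw [step f hf j, ih]
    linear_combination (-coeff 0 f) * step _ hE j

/-- The `q`-difference equation in `x` of `₀φ₁`. -/
theorem qDiff_unique (h : Generic c q) {y : K} {f g : PowerSeries K}
    (hf : C q * f - C (q + c) * rescale q f + C c * rescale q (rescale q f) =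
      C (q * y) * X * rescale q (rescale q f))
    (hg : C q * g - C (q + c) * rescale q g + C c * rescale q (rescale q g) =
      C (q * y) * X * rescale q (rescale q g))
    (h0 : coeff 0 f = coeff 0 g) : f = g := by
  have step : ∀ (g : PowerSeries K), C q * g - C (q + c) * rescale q g
      + C c * rescale q (rescale q g) = C (q * y) * X * rescale q (rescale q g) → ∀ j,
      (1 - q ^ (j + 1)) * (q * (1 - c * q ^ j)) * coeff (j + 1) g
        = q * y * (q ^ j * (q ^ j * coeff j g)) := by
    intro g hg j
    have := congrArg (coeff (j + 1)) hg
    rw [mul_assoc (C (q * y)), map_add, map_sub, coeff_C_mul, coeff_C_mul, coeff_C_mul, coeff_C_mul,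
      coeff_succ_X_mul] at this
    simp only [coeff_rescale] at this
    linear_combination this
  ext j
  induction j with
  | zero => exact h0
  | succ j ih =>
    have n2 : (1 - q ^ (j + 1)) * (q * (1 - c * q ^ j)) ≠ 0 := by
      refine mul_ne_zero (h.one_sub_pow_ne j) (mul_ne_zero h.q_ne ?_)
      simpa using h.one_sub_ne j
    apply mul_left_cancel₀ n2
    rw [step f hf j, step g hg j, ih]

theorem formalPhi_qDiff (h : Generic c q) (y : K) :
    C q * formalPhi c q y - C (q + c) * formalPhi c q (y * q) + C c * formalPhi c q (y * q * q) =
      C (q * y) * X * formalPhi c q (y * q * q) := by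
  ext j
  cases j with
  | zero => simp [mul_assoc]
  | succ j =>
    have n1 := h.qPoch_self_ne_zero j
    have n2 := h.one_sub_pow_ne j
    have n3 := h.qPoch_ne_zero j
    have n4 : 1 - c * q ^ j ≠ 0 := by simpa using h.one_sub_ne j
    rw [mul_assoc (C (q * y)), map_add, map_sub, coeff_C_mul, coeff_C_mul, coeff_C_mul, coeff_C_mul,
      coeff_succ_X_mul]
    simp only [formalPhi, coeff_mk]
    rw [qPoch_natCast_succ, qPoch_natCast_succ, pow_mul_pred_succ, ← pow_succ']
    field_simp
    ring

theorem formalJ_qDiff (h : Generic c q) (t : K) :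
    C q * formalJ c q t - C (q + c) * formalJ c q (t * q) + C c * formalJ c q (t * q * q) =
      C (q * t) * X * formalJ c q t := by
  ext j
  cases j with
  | zero => simp [mul_assoc]
  | succ j =>
    have n1 := h.qPoch_self_ne_zero j
    have n2 := h.one_sub_pow_ne j
    have n3 := h.qPoch_ne_zero j
    have n4 : 1 - c * q ^ j ≠ 0 := by simpa using h.one_sub_ne j
    rw [mul_assoc (C (q * t)), map_add, map_sub, coeff_C_mul, coeff_C_mul, coeff_C_mul, coeff_C_mul,
      coeff_succ_X_mul]
    simp only [formalJ, coeff_mk]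
    rw [qPoch_natCast_succ, qPoch_natCast_succ, ← pow_succ']
    field_simp
    ring

/-- Jackson's identity between the two `q`-Bessel functions. -/
theorem formalPhi_eq (h : Generic c q) (t : K) :
    formalPhi c q (c * t) = formalE q t * formalJ c q t := by
  refine qDiff_unique h (y := c * t) ?_ ?_ ?_
  · simp only [rescale_formalPhi]
    exact formalPhi_qDiff h _
  · simp only [map_mul, rescale_formalE, rescale_formalJ]
    have e1 := formalE_mul h t
    have e2 := formalE_mul h (t * q)
    have e3 := formalJ_qDiff h t
    -- With everything expressed through (tq²X;q)_∞, the ₀φ₁ equation for the product is (1 - tqX)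
    -- times the equation of `formalJ`.
    rw [← e1, ← e2]
    simp only [map_mul, map_add] at e3 ⊢
    linear_combination (formalE q (t * q * q) * (1 - C t * C q * X)) * e3
  · simp [coeff_mul]

/-- The Casoratian of the two formal solutions. -/
theorem casoratian (h : Generic c q) :
    C ((1 - c) * (c - q)) * formalPhi (q / c) q (q / c ^ 2) * formalPhi c q 1
      - X * formalPhi (c * q) q q * formalPhi (q ^ 2 / c) q (q ^ 2 / c ^ 2) =
    C ((1 - c) * (c - q)) * formalE q (1 / c) := by
  have hc := h.c_ne
  have hD : Generic (q / c) q := by simpa using h.zpow_div 1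
  have eD : q / c * q = q ^ 2 / c := by ring
  have r1 := formalPhi_sub h 1
  have r2 := formalPhi_contig h q
  have r3 := formalPhi_contig hD (q / c ^ 2 * q)
  have r4 := formalPhi_sub hD (q / c ^ 2)
  rw [eD] at r3 r4
  rw [one_mul, one_mul] at r1
  have y1 : q / c ^ 2 * q = q ^ 2 / c ^ 2 := by ring
  have y2 : q / c ^ 2 * q ^ 2 = q ^ 2 / c ^ 2 * q := by ring
  rw [y2, y1] at r4
  rw [y1] at r3
  have r5 := formalPhi_contig h 1
  set w := C ((1 - c) * (c - q)) * formalPhi (q / c) q (q / c ^ 2) * formalPhi c q 1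
      - X * formalPhi (c * q) q q * formalPhi (q ^ 2 / c) q (q ^ 2 / c ^ 2) with hw
  -- The contiguous relations at X and qX show that w solves the first-order equation of (X/c;q)_∞;
  -- its constant term then fixes it.
  have key : rescale q w * (1 - C (1 / c) * X) = w := by
    rw [hw]
    simp only [map_sub, map_mul, rescale_C, rescale_X, rescale_formalPhi, one_mul, y1] at *
    rw [← pow_two] at *
    set a := formalPhi c q 1
    set b := formalPhi (c * q) q q
    set F12 := formalPhi (c * q) q (q ^ 2)
    set F01 := formalPhi c q q
    set α := formalPhi (q ^ 2 / c) q (q ^ 2 / c ^ 2)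
    set α' := formalPhi (q ^ 2 / c) q (q ^ 2 / c ^ 2 * q)
    set β := formalPhi (q / c) q (q / c ^ 2)
    set β' := formalPhi (q / c) q (q ^ 2 / c ^ 2)
    have hi : C c * C c⁻¹ = 1 := by rw [← map_mul, mul_inv_cancel₀ hc, map_one]
    simp only [div_eq_mul_inv, one_mul, map_mul, map_one, ← inv_pow, map_pow] at r1 r2 r3 r4 ⊢
    have e1 : (C c - C q) * β' = C c * α - C q * α' := by
      linear_combination C c * r3 + (C q * β' - C q * α') * hi
    have e2 : (C c - C q) * (β - β') = C q * C c⁻¹ * X * α' := by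
      linear_combination C c * r4 + (C q * (β - β') + C q * C c⁻¹ * X * α') * hi
    have e3 : C c⁻¹ * (C c - C q) * β' = α - C q * C c⁻¹ * α' := by
      linear_combination r3 + β' * hi
    have e4 : (C c - X) * F12 = b - (1 - C c) * a := by
      linear_combination r2 + r1
    linear_combination (-(1 - C c⁻¹ * X) * (C c - C q) * β') * r1
      - (1 - C c⁻¹ * X) * X * F12 * e1 + X ^ 2 * α * F12 * hi - X * α * e4
      - (1 - C c) * a * e2 - X * (1 - C c) * a * e3
  have := eq_C_mul_formalE h key
  rw [this]
  congr 2
  simp [hw]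

end FormalSeries

/-! ### Solutions of the contiguous relations on ℤ × ℤ. -/

section Contiguity

/-- The two contiguous relations of the family `(m, n) ↦ ₀φ₁(–; cq^m; q, xq^n)`. -/
structure IsContig {R : Type*} [Field R] (c q x : R) (Y : ℤ → ℤ → R) : Prop where
  sub_eq : ∀ m n : ℤ, (1 - c * q ^ m) * (Y m n - Y m (n + 1)) = x * q ^ n * Y (m + 1) (n + 2)
  eq_sub : ∀ m n : ℤ, (1 - c * q ^ m) * Y m n = Y (m + 1) n - c * q ^ m * Y (m + 1) (n + 1)

namespace IsContig
variable {R : Type*} [Field R] {c q x : R} {Y Z : ℤ → ℤ → R}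

theorem const_mul (hY : IsContig c q x Y) (a : R) : IsContig c q x fun m n => a * Y m n where
  sub_eq m n := by linear_combination a * hY.sub_eq m n
  eq_sub m n := by linear_combination a * hY.eq_sub m n

theorem sub (hY : IsContig c q x Y) (hZ : IsContig c q x Z) :
    IsContig c q x fun m n => Y m n - Z m n where
  sub_eq m n := by linear_combination hY.sub_eq m n - hZ.sub_eq m n
  eq_sub m n := by linear_combination hY.eq_sub m n - hZ.eq_sub m n

/-- Eliminating row m - 1 between the two relations leaves a recurrence inside row m. -/
theorem three_term (hY : IsContig c q x Y) (m n : ℤ) :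
    (c * q ^ (m - 1) - x * q ^ n) * Y m (n + 2) =
      (1 + c * q ^ (m - 1)) * Y m (n + 1) - Y m n := by
  have h1 := hY.sub_eq (m - 1) n
  have h2 := hY.eq_sub (m - 1) n
  have h3 := hY.eq_sub (m - 1) (n + 1)
  rw [sub_add_cancel] at h1 h2 h3
  rw [show n + 1 + 1 = n + 2 by ring] at h3
  linear_combination h1 - h2 + h3

/-- Induction along the lattice: from `(0,0)` and `(1,1)`, a property that is stable under the
contiguous relations spreads to all of `ℤ × ℤ`. -/
theorem lattice_induction {Q : ℤ → ℤ → Prop} (h00 : Q 0 0) (h10 : Q 1 0) (h11 : Q 1 1)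
    (row_up : ∀ n : ℤ, 0 ≤ n → Q 1 n → Q 1 (n + 1) → Q 1 (n + 2))
    (row_down : ∀ n : ℤ, n < 0 → Q 1 (n + 1) → Q 1 (n + 2) → Q 1 n)
    (zero_up : ∀ n : ℤ, 0 ≤ n → Q 0 n → (∀ k, Q 1 k) → Q 0 (n + 1))
    (zero_down : ∀ n : ℤ, n < 0 → Q 0 (n + 1) → Q 1 (n + 2) → Q 0 n)
    (down : ∀ m n : ℤ, m < 0 → Q (m + 1) n → Q (m + 1) (n + 1) → Q m n)
    (up : ∀ m n : ℤ, 1 ≤ m → Q m n → Q m (n + 1) → Q (m + 1) (n + 2)) (m n : ℤ) : Q m n := by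
  -- Row 1 is filled in both directions, then row 0 from row 1, then the rows above and below. The
  -- sign conditions in the hypotheses record the direction of travel, on which the pole and degree
  -- bounds depend.
  have r1 : ∀ k : ℕ, Q 1 k ∧ Q 1 (k + 1) := by
    intro k
    induction k with
    | zero => exact ⟨h10, by simpa using h11⟩
    | succ k ih =>
      refine ⟨by simpa using ih.2, ?_⟩
      have := row_up k (by omega) ih.1 ih.2
      push_cast; rwa [add_assoc]
  have r2 : ∀ k : ℕ, Q 1 (-k) ∧ Q 1 (-k + 1) := by
    intro k
    induction k with
    | zero => exact ⟨by simpa using h10, by simpa using h11⟩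
    | succ k ih =>
      have e1 : (-((k + 1 : ℕ) : ℤ) + 1) = -k := by push_cast; ring
      have e2 : (-((k + 1 : ℕ) : ℤ) + 2) = -k + 1 := by push_cast; ring
      rw [e1]
      refine ⟨row_down _ (by push_cast; omega) ?_ ?_, ih.1⟩
      · rw [e1]; exact ih.1
      · rw [e2]; exact ih.2
  have row : ∀ n, Q 1 n := by
    intro n
    obtain ⟨k, rfl | rfl⟩ := n.eq_nat_or_neg
    exacts [(r1 k).1, (r2 k).1]
  have zero : ∀ n, Q 0 n := by
    intro n
    induction n using Int.induction_on with
    | zero => exact h00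
    | succ i ih => exact zero_up i (by omega) ih row
    | pred i ih => exact zero_down _ (by omega) (by rwa [sub_add_cancel]) (row _)
  obtain ⟨k, rfl | rfl⟩ := m.eq_nat_or_neg
  · cases k with
    | zero => exact zero n
    | succ k =>
      induction k generalizing n with
      | zero => exact row n
      | succ k ih =>
        have := up ((k + 1 : ℕ) : ℤ) (n - 2) (by omega) (ih _) (ih _)
        rw [sub_add_cancel] at this
        exact_mod_cast this
  · induction k generalizing n with
    | zero => simpa using zero n
    | succ k ih =>
      have e1 : (-((k + 1 : ℕ) : ℤ) + 1) = -k := by push_cast; ring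
      refine down _ n (by push_cast; omega) ?_ ?_ <;> rw [e1] <;> exact ih _

/-- Each propagation step divides at most by some 1 - cq^k, by xq^n or by some cq^k - xq^l. Hence
the solution space has dimension at most two. -/
theorem eq_zero (hY : IsContig c q x Y) (hc : ∀ k : ℤ, 1 - c * q ^ k ≠ 0) (hq : q ≠ 0) (hx : x ≠ 0)
    (hcx : ∀ k l : ℤ, c * q ^ k - x * q ^ l ≠ 0) (h00 : Y 0 0 = 0) (h11 : Y 1 1 = 0) (m n : ℤ) :
    Y m n = 0 := by
  refine lattice_induction (Q := fun m n => Y m n = 0) h00 ?_ h11 ?_ ?_ ?_ ?_ ?_ ?_ m n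
  · have := hY.eq_sub 0 0
    simpa [h00, h11] using this.symm
  · intro n _ h1 h2
    have := hY.three_term 1 n
    rw [h1, h2, mul_zero, sub_zero] at this
    exact (mul_eq_zero.1 this).resolve_left (hcx _ _)
  · intro n _ h1 h2
    have := hY.three_term 1 n
    rw [h1, h2] at this
    linear_combination this
  · intro n _ h1 h2
    have := hY.sub_eq 0 n
    rw [zero_add, h2 (n + 2), h1, mul_zero, zero_sub] at this
    simpa using (mul_eq_zero.1 this).resolve_left (hc _)
  · intro n _ h1 h2
    have := hY.sub_eq 0 n
    rw [zero_add, h2, h1, mul_zero, sub_zero] at this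
    exact (mul_eq_zero.1 this).resolve_left (hc _)
  · intro m n _ h1 h2
    have := hY.eq_sub m n
    rw [h2, h1, mul_zero, sub_zero] at this
    exact (mul_eq_zero.1 this).resolve_left (hc _)
  · intro m n _ h1 h2
    have := hY.sub_eq m n
    rw [h2, h1, sub_zero, mul_zero] at this
    exact (mul_eq_zero.1 this.symm).resolve_left (mul_ne_zero hx (zpow_ne_zero _ hq))

theorem ext (hY : IsContig c q x Y) (hZ : IsContig c q x Z) (hc : ∀ k : ℤ, 1 - c * q ^ k ≠ 0)
    (hq : q ≠ 0) (hx : x ≠ 0) (hcx : ∀ k l : ℤ, c * q ^ k - x * q ^ l ≠ 0)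
    (h00 : Y 0 0 = Z 0 0) (h11 : Y 1 1 = Z 1 1) (m n : ℤ) : Y m n = Z m n :=
  sub_eq_zero.1 ((hY.sub hZ).eq_zero hc hq hx hcx (sub_eq_zero.2 h00) (sub_eq_zero.2 h11) m n)

end IsContig

end Contiguity

/-! ### Two Laurent series solutions, and U by Cramer's rule. -/

section Laurent

variable {K : Type*} [Field K]

/-- Power series as Laurent series. -/
noncomputable abbrev toLaurent (K : Type*) [Field K] : PowerSeries K →+* LaurentSeries K :=
  HahnSeries.ofPowerSeries ℤ K

/-- Constants as Laurent series. -/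
noncomputable def constL (K : Type*) [Field K] : K →+* LaurentSeries K :=
  (toLaurent K).comp PowerSeries.C

theorem toLaurent_C (a : K) : toLaurent K (PowerSeries.C a) = constL K a := rfl

/-- The variable of the field of Laurent series. -/
noncomputable def varL (K : Type*) [Field K] : LaurentSeries K := toLaurent K PowerSeries.X

theorem toLaurent_X : toLaurent K PowerSeries.X = varL K := rfl

theorem toLaurent_injective : Function.Injective (toLaurent K) :=
  HahnSeries.ofPowerSeries_injective

theorem varL_ne_zero : varL K ≠ 0 := by
  rw [varL, Ne, map_eq_zero_iff _ toLaurent_injective]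
  exact PowerSeries.X_ne_zero

variable {c q : K}

theorem isContig_first (h : Generic c q) :
    IsContig (constL K c) (constL K q) (varL K)
      fun m n => toLaurent K (formalPhi (c * q ^ m) q (q ^ n)) where
  sub_eq m n := by
    have := congrArg (toLaurent K) (formalPhi_sub (h.mul_zpow m) (q ^ n))
    simp only [map_mul, map_sub, map_one, toLaurent_C, toLaurent_X, map_zpow₀] at this
    rw [mul_assoc c, ← zpow_add_one₀ h.q_ne, ← zpow_add_one₀ h.q_ne, ← zpow_natCast q 2,
      ← zpow_add₀ h.q_ne] at this
    push_cast at this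
    linear_combination this
  eq_sub m n := by
    have := congrArg (toLaurent K) (formalPhi_contig (h.mul_zpow m) (q ^ n))
    simp only [map_mul, map_sub, map_one, toLaurent_C, map_zpow₀] at this
    rw [mul_assoc c, ← zpow_add_one₀ h.q_ne, ← zpow_add_one₀ h.q_ne] at this
    linear_combination this

/-- The normalization of the second solution. -/
noncomputable def secondCoeff (c q : K) (m n : ℤ) : K :=
  qPoch c q m * c ^ (2 * m - n) * q ^ (m * (m - 1) + n - n * m) / qPoch (q ^ 2 / c) q (-m)

/-- This ratio and the one in `secondCoeff_succ_left` are what the contiguous relations demand of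
the normalizing constant. -/
theorem secondCoeff_succ_right (h : Generic c q) (m n : ℤ) :
    secondCoeff c q m (n + 1) = secondCoeff c q m n * (q ^ (1 - m) / c) := by
  have hq := h.q_ne
  have hc := h.c_ne
  rw [secondCoeff, secondCoeff, show 2 * m - (n + 1) = 2 * m - n - 1 by ring,
    show m * (m - 1) + (n + 1) - (n + 1) * m = (m * (m - 1) + n - n * m) + (1 - m) by ring,
    zpow_add₀ hq, zpow_sub_one₀ hc]
  field_simp

theorem secondCoeff_succ_left (h : Generic c q) (m n : ℤ) :
    secondCoeff c q (m + 1) n = secondCoeff c q m n *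
      ((1 - q ^ (1 - m) / c) * (1 - c * q ^ m) * (c ^ 2 * q ^ (2 * m - n))) := by
  have hq := h.q_ne
  have hc := h.c_ne
  have h2 : Generic (q ^ 2 / c) q := by exact_mod_cast h.zpow_div 2
  have n1 := h2.qPoch_ne_zero (-m)
  have n2 := h2.qPoch_ne_zero (-(m + 1))
  have e := h2.qPoch_add_one (-(m + 1))
  rw [show -(m + 1) + 1 = -m by ring, div_mul_eq_mul_div, ← zpow_natCast q 2, ← zpow_add₀ hq,
    show (((2 : ℕ) : ℤ) + -(m + 1)) = 1 - m by push_cast; ring] at e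
  rw [secondCoeff, secondCoeff, h.qPoch_add_one, show 2 * (m + 1) - n = 2 * m - n + (2 : ℕ) by
    push_cast; ring, show (m + 1) * (m + 1 - 1) + n - n * (m + 1) =
      (m * (m - 1) + n - n * m) + (2 * m - n) by ring, zpow_add₀ hq _ (2 * m - n), zpow_add₀ hc,
    zpow_natCast c 2, div_mul_eq_mul_div, div_eq_div_iff n2 n1]
  rw [zpow_natCast q 2] at e
  rw [e]
  ring

/-- With c = q^γ, the second local solution at x = 0 is x^{1-γ} ₀φ₁(–; q²/c; q, q²x/c²). Of the
power of x only x^{-m} depends on the lattice point, apart from constants, so the solution can be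
written without γ. Since c ↦ q²/c reverses shifts of c, the two relations exchange roles:
`formalPhi_contig` gives `sub_eq`, and `formalPhi_sub` gives `eq_sub`. -/
theorem isContig_second (h : Generic c q) :
    IsContig (constL K c) (constL K q) (varL K)
      fun m n => constL K (secondCoeff c q m n) * varL K ^ (-m) *
        toLaurent K (formalPhi (q ^ (2 - m) / c) q (q ^ (n + 2 - 2 * m) / c ^ 2)) where
  sub_eq m n := by
    have hq := h.q_ne
    have hc := h.c_ne
    have h1 := h.zpow_div (1 - m)
    have e1 : q ^ (1 - m) / c * q = q ^ (2 - m) / c := by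
      rw [div_mul_eq_mul_div, ← zpow_add_one₀ hq]; congr 2; ring
    have e2 : q ^ (n + 2 - 2 * m) / c ^ 2 * q = q ^ (n + 1 + 2 - 2 * m) / c ^ 2 := by
      rw [div_mul_eq_mul_div, ← zpow_add_one₀ hq]; congr 2; ring
    have := congrArg (toLaurent K) (formalPhi_contig h1 (q ^ (n + 2 - 2 * m) / c ^ 2))
    rw [e1, e2] at this
    simp only [map_mul, map_sub, map_one, toLaurent_C] at this
    have e3 : secondCoeff c q (m + 1) (n + 2) * q ^ n =
        secondCoeff c q m n * (1 - q ^ (1 - m) / c) * (1 - c * q ^ m) := by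
      rw [show n + 2 = n + 1 + 1 by ring, secondCoeff_succ_right h, secondCoeff_succ_right h,
        secondCoeff_succ_left h]
      have : c ^ 2 * q ^ (2 * m - n) * (q ^ (1 - (m + 1)) / c) * (q ^ (1 - (m + 1)) / c) * q ^ n
          = 1 := by
        field_simp
        rw [← zpow_natCast, ← zpow_mul, ← zpow_add₀ hq, ← zpow_add₀ hq, ← zpow_zero q]
        congr 1; push_cast; ring
      linear_combination (secondCoeff c q m n * ((1 - q ^ (1 - m) / c) * (1 - c * q ^ m))) * this
    have e3' := congrArg (constL K) e3
    have e4 := congrArg (constL K) (secondCoeff_succ_right h m n)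
    simp only [map_mul, map_sub, map_one, map_zpow₀] at e3' e4
    have e5 : varL K ^ (-(m + 1)) * varL K = varL K ^ (-m) := by
      rw [← zpow_add_one₀ varL_ne_zero]; congr 1; ring
    rw [e4, show 2 - (m + 1) = 1 - m by ring, show n + 2 + 2 - 2 * (m + 1) = n + 2 - 2 * m by ring]
    set A := toLaurent K (formalPhi (q ^ (2 - m) / c) q (q ^ (n + 2 - 2 * m) / c ^ 2))
    set B := toLaurent K (formalPhi (q ^ (2 - m) / c) q (q ^ (n + 1 + 2 - 2 * m) / c ^ 2))
    set D := toLaurent K (formalPhi (q ^ (1 - m) / c) q (q ^ (n + 2 - 2 * m) / c ^ 2))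
    linear_combination (-(1 - constL K c * constL K q ^ m) * constL K (secondCoeff c q m n) *
      varL K ^ (-m)) * this - varL K ^ (-m) * D * e3' -
      D * constL K (secondCoeff c q (m + 1) (n + 2)) * constL K q ^ n * e5
  eq_sub m n := by
    have hq := h.q_ne
    have hc := h.c_ne
    have h1 := h.zpow_div (1 - m)
    have e1 : q ^ (1 - m) / c * q = q ^ (2 - m) / c := by
      rw [div_mul_eq_mul_div, ← zpow_add_one₀ hq]; congr 2; ring
    have e2 : q ^ (n - 2 * m) / c ^ 2 * q = q ^ (n + 1 - 2 * m) / c ^ 2 := by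
      rw [div_mul_eq_mul_div, ← zpow_add_one₀ hq]; congr 2; ring
    have e2' : q ^ (n - 2 * m) / c ^ 2 * q ^ 2 = q ^ (n + 2 - 2 * m) / c ^ 2 := by
      rw [div_mul_eq_mul_div, ← zpow_natCast q 2, ← zpow_add₀ hq]; congr 2; push_cast; ring
    have := congrArg (toLaurent K) (formalPhi_sub h1 (q ^ (n - 2 * m) / c ^ 2))
    rw [e1, e2, e2'] at this
    simp only [map_mul, map_sub, map_one, toLaurent_C, toLaurent_X] at this
    have e4 : secondCoeff c q (m + 1) (n + 1) * (c * q ^ m) = secondCoeff c q (m + 1) n := by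
      rw [secondCoeff_succ_right h, show 1 - (m + 1) = -m by ring, zpow_neg]
      field_simp
    have e4' := congrArg (constL K) e4
    have e6 : constL K (c ^ 2 * q ^ (2 * m - n)) * constL K (q ^ (n - 2 * m) / c ^ 2) = 1 := by
      rw [← map_mul, ← map_one (constL K)]
      congr 1
      field_simp
      rw [← zpow_add₀ hq, ← zpow_zero q]; congr 1; ring
    have e5 : varL K ^ (-(m + 1)) * varL K = varL K ^ (-m) := by
      rw [← zpow_add_one₀ varL_ne_zero]; congr 1; ring
    rw [show 2 - (m + 1) = 1 - m by ring, show n + 2 - 2 * (m + 1) = n - 2 * m by ring,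
      show n + 1 + 2 - 2 * (m + 1) = n + 1 - 2 * m by ring]
    have e3' := congrArg (constL K) (secondCoeff_succ_left h m n)
    set P := c ^ 2 * q ^ (2 * m - n)
    simp only [map_mul, map_sub, map_one, map_zpow₀] at e3' e4'
    set A := toLaurent K (formalPhi (q ^ (1 - m) / c) q (q ^ (n - 2 * m) / c ^ 2))
    set B := toLaurent K (formalPhi (q ^ (1 - m) / c) q (q ^ (n + 1 - 2 * m) / c ^ 2))
    set D := toLaurent K (formalPhi (q ^ (2 - m) / c) q (q ^ (n + 2 - 2 * m) / c ^ 2))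
    set κ := constL K (secondCoeff c q m n)
    set r := 1 - constL K c * constL K q ^ m
    linear_combination varL K ^ (-(m + 1)) * B * e4' - varL K ^ (-(m + 1)) * (A - B) * e3'
      - κ * r * constL K P * varL K ^ (-(m + 1)) * this
      - κ * r * varL K ^ (-(m + 1)) * varL K * D * e6 - κ * r * D * e5

theorem secondCoeff_zero (c q : K) : secondCoeff c q 0 0 = 1 := by
  simp [secondCoeff]

theorem secondCoeff_one (h : Generic c q) : secondCoeff c q 1 1 = (1 - c) * (c - q) := by
  have hc := h.c_ne
  have e1 := secondCoeff_succ_right h 1 0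
  have e2 := secondCoeff_succ_left h 0 0
  have e3 := secondCoeff_succ_right h 0 0
  rw [zero_add] at e1 e2 e3
  rw [e1, e2, secondCoeff_zero]
  simp
  field_simp

theorem formalE_ne_zero (q t : K) : formalE q t ≠ 0 := by
  intro h
  have := coeff_zero_formalE q t
  simp [h] at this

/-- The Laurent expansion in `x` of the coefficient `U` of the recurrence. -/
noncomputable def laurentU (c q : K) (m n : ℤ) : LaurentSeries K :=
  varL K * (constL K ((1 - c) * (c - q)) * toLaurent K (formalE q (1 / c)))⁻¹ *
    (toLaurent K (formalPhi c q 1) * (constL K (secondCoeff c q m n) * varL K ^ (-m) *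
        toLaurent K (formalPhi (q ^ (2 - m) / c) q (q ^ (n + 2 - 2 * m) / c ^ 2)))
      - toLaurent K (formalPhi (q ^ 2 / c) q (q ^ 2 / c ^ 2)) *
        toLaurent K (formalPhi (c * q ^ m) q (q ^ n)))

/-- `laurentU` combines the two solutions with factors independent of (m,n). The factors are chosen
by Cramer's rule to give 0 at (0,0) and, by the Casoratian, 1 at (1,1). -/
theorem isContig_laurentU (h : Generic c q) :
    IsContig (constL K c) (constL K q) (varL K) (laurentU c q) :=
  (((isContig_second h).const_mul _).sub ((isContig_first h).const_mul _)).const_mul _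

theorem laurentU_zero (c q : K) : laurentU c q 0 0 = 0 := by
  have e : q ^ (2 : ℤ) = q ^ 2 := by exact_mod_cast zpow_natCast q 2
  simp [laurentU, secondCoeff_zero, e, mul_comm]

theorem Generic.ne (h : Generic c q) : c - q ≠ 0 := by
  have := h.c_zpow (-1)
  intro h0
  apply this
  rw [sub_eq_zero.1 h0, zpow_neg_one, mul_inv_cancel₀ h.q_ne]

theorem laurentU_one (h : Generic c q) : laurentU c q 1 1 = 1 := by
  have e : q ^ (2 : ℤ) = q ^ 2 := by exact_mod_cast zpow_natCast q 2
  have h1 := congrArg (toLaurent K) (casoratian h)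
  rw [map_sub, map_mul _ _ (formalE q (1 / c)), toLaurent_C] at h1
  have h2 : constL K ((1 - c) * (c - q)) * toLaurent K (formalE q (1 / c)) ≠ 0 := by
    refine mul_ne_zero ?_ ?_
    · rw [map_ne_zero]; exact mul_ne_zero h.one_sub_ne' h.ne
    · rw [Ne, map_eq_zero_iff _ toLaurent_injective]; exact formalE_ne_zero _ _
  rw [laurentU, mul_right_comm, mul_inv_eq_one₀ h2, ← h1, secondCoeff_one h]
  simp only [map_mul (toLaurent K), toLaurent_C, toLaurent_X]
  norm_num
  field_simp [varL_ne_zero]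
  

end Laurent

/-! ### Coefficients of the products as terminating ₂φ₁ series. -/

section CauchyProducts

open PowerSeries

variable {K : Type*} [Field K] {a b c q : K}

/-- Reversal contributes q^{2ik+i²} with k = j - i. Together with q^{i(i-1)} the exponent becomes
i(2j-1), linear in i, so a ₂φ₁ whose argument involves q^{2j} results. In the opposite order of
factors, q^{k(k-1)} leaves the exponent j(j-1) + i, and the argument is free of j; this is the
difference between A, B̃ and Ã, B. -/
theorem coeff_formalPhi_mul_formalJ (hg : Generic c q) (ha : a ≠ 0)
    (ha' : ∀ k : ℕ, qPoch a q (k : ℤ) ≠ 0) {z : K} (hz : z ≠ 0) (w : K) (j : ℕ) :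
    coeff j (formalPhi b q w * formalJ a q z) =
      z ^ j / (qPoch q q (j : ℤ) * qPoch a q (j : ℤ)) *
        phi21 j (q ^ (1 - (j : ℤ)) / a) b q (w * a * q ^ (2 * (j : ℤ) - 1) / z) := by
  have hq := hg.q_ne
  rw [coeff_mul, Finset.Nat.sum_antidiagonal_eq_sum_range_succ
    (fun i k => coeff i (formalPhi b q w) * coeff k (formalJ a q z)), phi21, Finset.mul_sum]
  refine Finset.sum_congr rfl fun i hi => ?_
  obtain ⟨k, rfl⟩ := Nat.exists_eq_add_of_le (Nat.lt_succ_iff.1 (Finset.mem_range.1 hi))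
  have key := qPoch_reverse_mul hg ha ha' i k
  rw [Nat.add_sub_cancel_left]
  simp only [formalPhi, formalJ, coeff_mk]
  have e1 : (w * a * q ^ (2 * ((i + k : ℕ) : ℤ) - 1) / z) ^ i * z ^ (i + k) =
      q ^ (i * (i - 1)) * w ^ i * z ^ k * (a ^ i * q ^ (2 * (i * k) + i * i)) := by
    have : (q ^ (2 * ((i + k : ℕ) : ℤ) - 1)) ^ i = q ^ (i * (i - 1)) * q ^ (2 * (i * k) + i * i) := by
      rw [← pow_add, ← zpow_natCast, ← zpow_natCast, ← zpow_mul]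
      congr 1
      cases i with
      | zero => simp
      | succ i => rw [Nat.add_sub_cancel]; push_cast; ring
    rw [div_pow, mul_pow, mul_pow, this, pow_add z]
    field_simp
  rw [div_mul_div_comm, show q ^ (i * (i - 1)) * w ^ i * z ^ k /
    (qPoch q q (i : ℤ) * qPoch b q (i : ℤ) * (qPoch q q (k : ℤ) * qPoch a q (k : ℤ))) =
    q ^ (i * (i - 1)) * w ^ i * z ^ k / (qPoch q q (i : ℤ) * qPoch b q (i : ℤ)) *
      (1 / (qPoch q q (k : ℤ) * qPoch a q (k : ℤ))) by rw [mul_one_div, div_div], key]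
  linear_combination (-(1 / (qPoch q q (i : ℤ) * qPoch b q (i : ℤ)) *
    (qPoch (q ^ (-((i + k : ℕ) : ℤ))) q (i : ℤ) * qPoch (q ^ (1 - ((i + k : ℕ) : ℤ)) / a) q (i : ℤ)
        / (qPoch q q ((i + k : ℕ) : ℤ) * qPoch a q ((i + k : ℕ) : ℤ))))) * e1

theorem coeff_formalJ_mul_formalPhi (hg : Generic c q) (ha : a ≠ 0)
    (ha' : ∀ k : ℕ, qPoch a q (k : ℤ) ≠ 0) {w : K} (hw : w ≠ 0) (z : K) (j : ℕ) :
    coeff j (formalJ b q z * formalPhi a q w) =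
      w ^ j * q ^ (j * (j - 1)) / (qPoch q q (j : ℤ) * qPoch a q (j : ℤ)) *
        phi21 j (q ^ (1 - (j : ℤ)) / a) b q (a * q * z / w) := by
  have hq := hg.q_ne
  rw [coeff_mul, Finset.Nat.sum_antidiagonal_eq_sum_range_succ
    (fun i k => coeff i (formalJ b q z) * coeff k (formalPhi a q w)), phi21, Finset.mul_sum]
  refine Finset.sum_congr rfl fun i hi => ?_
  obtain ⟨k, rfl⟩ := Nat.exists_eq_add_of_le (Nat.lt_succ_iff.1 (Finset.mem_range.1 hi))
  have key := qPoch_reverse_mul hg ha ha' i k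
  rw [Nat.add_sub_cancel_left]
  simp only [formalPhi, formalJ, coeff_mk]
  have e1 : (a * q * z / w) ^ i * (w ^ (i + k) * q ^ ((i + k) * (i + k - 1))) =
      z ^ i * (q ^ (k * (k - 1)) * w ^ k) * (a ^ i * q ^ (2 * (i * k) + i * i)) := by
    have : q ^ i * q ^ ((i + k) * (i + k - 1)) = q ^ (k * (k - 1)) * q ^ (2 * (i * k) + i * i) := by
      rw [← pow_add, ← pow_add]
      congr 1
      cases k with
      | zero => cases i with
        | zero => simp
        | succ i => simp only [Nat.add_sub_cancel, add_zero]; ring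
      | succ k => simp only [Nat.add_sub_cancel, ← add_assoc]; ring
    rw [div_pow, mul_pow, mul_pow, pow_add w]
    field_simp
    linear_combination z ^ i * this
  rw [div_mul_div_comm, show z ^ i * (q ^ (k * (k - 1)) * w ^ k) /
    (qPoch q q (i : ℤ) * qPoch b q (i : ℤ) * (qPoch q q (k : ℤ) * qPoch a q (k : ℤ))) =
    z ^ i * (q ^ (k * (k - 1)) * w ^ k) / (qPoch q q (i : ℤ) * qPoch b q (i : ℤ)) *
      (1 / (qPoch q q (k : ℤ) * qPoch a q (k : ℤ))) by rw [mul_one_div, div_div], key]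
  linear_combination (-(1 / (qPoch q q (i : ℤ) * qPoch b q (i : ℤ)) *
    (qPoch (q ^ (-((i + k : ℕ) : ℤ))) q (i : ℤ) * qPoch (q ^ (1 - ((i + k : ℕ) : ℤ)) / a) q (i : ℤ)
        / (qPoch q q ((i + k : ℕ) : ℤ) * qPoch a q ((i + k : ℕ) : ℤ))))) * e1

theorem Generic.sq_div (h : Generic c q) : Generic (q ^ 2 / c) q := by
  exact_mod_cast h.zpow_div 2

/-- This merges the denominator of `secondCoeff` with that of the series into the single
(q²/c;q)_{j-m} of A and Ã. -/
theorem Generic.qPoch_sq_div (h : Generic c q) (m j : ℤ) :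
    qPoch (q ^ 2 / c) q (j - m) = qPoch (q ^ 2 / c) q (-m) * qPoch (q ^ (2 - m) / c) q j := by
  rw [show j - m = -m + j by ring, h.sq_div.qPoch_add]
  congr 2
  rw [div_mul_eq_mul_div, ← zpow_natCast q 2, ← zpow_add₀ h.q_ne]; congr 2

theorem coeff_eq_coeffA (h : Generic c q) (m n : ℤ) (j : ℕ) :
    secondCoeff c q m n * coeff j (formalPhi c q 1 * formalJ (q ^ (2 - m) / c) q (q ^ (n - m) / c)) =
      coeffA m n c q j := by
  have hq := h.q_ne
  have hc := h.c_ne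
  have hD := h.zpow_div (2 - m)
  rw [coeff_formalPhi_mul_formalJ h hD.c_ne (fun k => hD.qPoch_ne_zero k)
    (div_ne_zero (zpow_ne_zero _ hq) hc), coeffA, if_neg (by omega), Int.toNat_natCast,
    h.qPoch_sq_div, secondCoeff]
  have e1 : q ^ (1 - (j : ℤ)) / (q ^ (2 - m) / c) = c * q ^ (m - j - 1) := by
    rw [div_div_eq_mul_div, mul_comm, mul_div_assoc, ← zpow_sub₀ hq]; congr 2; ring
  have e2 : 1 * (q ^ (2 - m) / c) * q ^ (2 * (j : ℤ) - 1) / (q ^ (n - m) / c) =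
      q ^ (2 * (j : ℤ) - n + 1) := by
    field_simp
    rw [← zpow_add₀ hq, ← zpow_add₀ hq]; congr 1; ring
  have e3 : q ^ (m * (m - 1) + n - n * m) * c ^ (2 * m - n) * (q ^ (n - m) / c) ^ j =
      c ^ (2 * m - n - j) * q ^ (((j : ℤ) - m + 1) * (n - m)) := by
    rw [div_pow, ← zpow_natCast, ← zpow_natCast, ← zpow_mul, zpow_sub₀ hc (2 * m - n),
      show ((j : ℤ) - m + 1) * (n - m) = (m * (m - 1) + n - n * m) + (n - m) * j by ring,
      zpow_add₀ hq]
    ring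
  rw [e1, e2]
  linear_combination (qPoch c q m / (qPoch q q (j : ℤ) *
    (qPoch (q ^ 2 / c) q (-m) * qPoch (q ^ (2 - m) / c) q (j : ℤ))) *
    phi21 j (c * q ^ (m - j - 1)) c q (q ^ (2 * (j : ℤ) - n + 1))) * e3

theorem coeff_eq_coeffA' (h : Generic c q) (m n : ℤ) (j : ℕ) :
    secondCoeff c q m n * coeff j (formalJ c q (1 / c) *
      formalPhi (q ^ (2 - m) / c) q (q ^ (n + 2 - 2 * m) / c ^ 2)) = coeffA' m n c q j := by
  have hq := h.q_ne
  have hc := h.c_ne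
  have hD := h.zpow_div (2 - m)
  rw [coeff_formalJ_mul_formalPhi h hD.c_ne (fun k => hD.qPoch_ne_zero k)
    (div_ne_zero (zpow_ne_zero _ hq) (pow_ne_zero _ hc)), coeffA', if_neg (by omega),
    Int.toNat_natCast, h.qPoch_sq_div, secondCoeff]
  have e1 : q ^ (1 - (j : ℤ)) / (q ^ (2 - m) / c) = c * q ^ (m - j - 1) := by
    rw [div_div_eq_mul_div, mul_comm, mul_div_assoc, ← zpow_sub₀ hq]; congr 2; ring
  have e2 : q ^ (2 - m) / c * q * (1 / c) / (q ^ (n + 2 - 2 * m) / c ^ 2) = q ^ (m - n + 1) := by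
    field_simp
    rw [← zpow_add₀ hq, ← zpow_add_one₀ hq]; congr 1; ring
  have e0 : q ^ (j * (j - 1)) = q ^ ((j : ℤ) * (j - 1)) := by
    rw [← zpow_natCast]; congr 1
    cases j with
    | zero => simp
    | succ j => rw [Nat.add_sub_cancel]; push_cast; ring
  have e3 : q ^ (m * (m - 1) + n - n * m) * c ^ (2 * m - n) *
      ((q ^ (n + 2 - 2 * m) / c ^ 2) ^ j * q ^ (j * (j - 1))) =
      c ^ (2 * m - n - 2 * j) * q ^ (((j : ℤ) - m + 1) * (j - m + n)) := by
    rw [e0, div_pow, ← zpow_natCast, ← zpow_natCast, ← zpow_natCast, ← zpow_mul, ← zpow_mul,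
      zpow_sub₀ hc (2 * m - n),
      show ((j : ℤ) - m + 1) * (j - m + n) =
        (m * (m - 1) + n - n * m) + (n + 2 - 2 * m) * j + j * (j - 1) by ring,
      zpow_add₀ hq, zpow_add₀ hq]
    push_cast
    ring
  rw [e1, e2]
  linear_combination (qPoch c q m / (qPoch q q (j : ℤ) *
    (qPoch (q ^ 2 / c) q (-m) * qPoch (q ^ (2 - m) / c) q (j : ℤ))) *
    phi21 j (c * q ^ (m - j - 1)) c q (q ^ (m - n + 1))) * e3

theorem coeff_eq_coeffB (h : Generic c q) (m n : ℤ) (j : ℕ) :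
    coeff j (formalJ (c * q ^ m) q (q ^ (n - m) / c) * formalPhi (q ^ 2 / c) q (q ^ 2 / c ^ 2)) =
      coeffB m n c q j := by
  have hq := h.q_ne
  have hc := h.c_ne
  have hD := h.sq_div
  rw [coeff_formalJ_mul_formalPhi h hD.c_ne (fun k => hD.qPoch_ne_zero k)
    (div_ne_zero (pow_ne_zero _ hq) (pow_ne_zero _ hc)), coeffB, if_neg (by omega),
    Int.toNat_natCast]
  have e1 : q ^ (1 - (j : ℤ)) / (q ^ 2 / c) = c * q ^ (-(j : ℤ) - 1) := by
    rw [div_div_eq_mul_div, mul_comm, mul_div_assoc, ← zpow_natCast q 2, ← zpow_sub₀ hq]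
    congr 2; push_cast; ring
  have e2 : q ^ 2 / c * q * (q ^ (n - m) / c) / (q ^ 2 / c ^ 2) = q ^ (n - m + 1) := by
    rw [zpow_add_one₀ hq]
    field_simp
  have e3 : (q ^ 2 / c ^ 2) ^ j * q ^ (j * (j - 1)) = c ^ (-2 * (j : ℤ)) * q ^ ((j : ℤ) * (j + 1)) := by
    have : q ^ ((j : ℤ) * (j + 1)) = (q ^ 2) ^ j * q ^ (j * (j - 1)) := by
      rw [← pow_mul, ← pow_add, ← zpow_natCast]; congr 1
      cases j with
      | zero => simp
      | succ j => rw [Nat.add_sub_cancel]; push_cast; ring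
    rw [this, div_pow, neg_mul, zpow_neg, zpow_mul, zpow_natCast]
    rw [show c ^ (2 : ℤ) = c ^ 2 by exact_mod_cast zpow_natCast c 2]
    ring
  rw [e1, e2]
  linear_combination (1 / (qPoch q q (j : ℤ) * qPoch (q ^ 2 / c) q (j : ℤ)) *
    phi21 j (c * q ^ (-(j : ℤ) - 1)) (c * q ^ m) q (q ^ (n - m + 1))) * e3

theorem coeff_eq_coeffB' (h : Generic c q) (m n : ℤ) (j : ℕ) :
    coeff j (formalPhi (c * q ^ m) q (q ^ n) * formalJ (q ^ 2 / c) q (1 / c)) =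
      coeffB' m n c q j := by
  have hq := h.q_ne
  have hc := h.c_ne
  have hD := h.sq_div
  rw [coeff_formalPhi_mul_formalJ h hD.c_ne (fun k => hD.qPoch_ne_zero k)
    (one_div_ne_zero hc), coeffB', if_neg (by omega), Int.toNat_natCast]
  have e1 : q ^ (1 - (j : ℤ)) / (q ^ 2 / c) = c * q ^ (-(j : ℤ) - 1) := by
    rw [div_div_eq_mul_div, mul_comm, mul_div_assoc, ← zpow_natCast q 2, ← zpow_sub₀ hq]
    congr 2; push_cast; ring
  have e2 : q ^ n * (q ^ 2 / c) * q ^ (2 * (j : ℤ) - 1) / (1 / c) = q ^ (2 * (j : ℤ) + n + 1) := by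
    field_simp
    rw [← zpow_natCast q 2, ← zpow_add₀ hq, ← zpow_add₀ hq]; congr 1; push_cast; ring
  rw [e1, e2, one_div_pow, zpow_neg, zpow_natCast]
  ring

end CauchyProducts

/-! ### The power series whose coefficients are the differences A - B or Ã - B̃. -/

section SeriesIdentity

variable {K : Type*} [Field K] {c q : K}

/-- Polynomials as Laurent series. -/
noncomputable def polyL (K : Type*) [Field K] : K[X] →+* LaurentSeries K :=
  (toLaurent K).comp Polynomial.coeToPowerSeries.ringHom

theorem polyL_apply (p : K[X]) : polyL K p = toLaurent K (p : PowerSeries K) := rfl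

theorem polyL_C (a : K) : polyL K (Polynomial.C a) = constL K a := by
  rw [polyL_apply, Polynomial.coe_C, toLaurent_C]

theorem polyL_X : polyL K Polynomial.X = varL K := by
  rw [polyL_apply, Polynomial.coe_X, toLaurent_X]

theorem polyL_injective : Function.Injective (polyL K) :=
  toLaurent_injective.comp (Polynomial.coe_injective K)

/-- The polynomial `(X/c; q)_N`. -/
noncomputable def denomPoly (c q : K) (N : ℕ) : K[X] :=
  ∏ i ∈ Finset.range N, (1 - Polynomial.C (q ^ i / c) * Polynomial.X)

theorem denomPoly_succ (c q : K) (N : ℕ) : denomPoly c q (N + 1) =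
    denomPoly c q N * (1 - Polynomial.C (q ^ N / c) * Polynomial.X) :=
  Finset.prod_range_succ _ _

theorem formalE_eq_denomPoly_mul (h : Generic c q) (N : ℕ) :
    formalE q (1 / c) = (denomPoly c q N : PowerSeries K) * formalE q (q ^ N / c) := by
  induction N with
  | zero => simp [denomPoly]
  | succ N ih =>
    have e := formalE_mul h (q ^ N / c)
    rw [ih, denomPoly_succ, ← e, Polynomial.coe_mul, Polynomial.coe_sub, Polynomial.coe_one,
      Polynomial.coe_mul, Polynomial.coe_C, Polynomial.coe_X, div_mul_eq_mul_div, ← pow_succ]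
    ring

theorem coeff_X_pow_mul_of_int {S : PowerSeries K} {a : ℤ → K} (hneg : ∀ k < 0, a k = 0)
    (ha : ∀ k : ℕ, PowerSeries.coeff k S = a k) (s j : ℕ) :
    PowerSeries.coeff j (PowerSeries.X ^ s * S) = a (j - s) := by
  rw [PowerSeries.coeff_X_pow_mul']
  split_ifs with hs
  · rw [ha, Nat.cast_sub hs]
  · rw [hneg _ (by omega)]

/-- The coefficients of `P01`, continued beyond the degree bound. -/
def coeffP (m n : ℤ) (c q : K) (j : ℤ) : K :=
  if m ≤ n then coeffA m n c q (j + min m 0) - coeffB m n c q (j - max m 0)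
  else coeffA' m n c q (j + min m 0) - coeffB' m n c q (j - max m 0)

/-- Since max(m,0) - m = -min(m,0), multiplication by x^{max(m,0)} makes both exponents nonnegative.
Extending the coefficients by zero to negative indices expresses these shifts without case
distinctions. -/
theorem varL_zpow_sub {m : ℤ} {S T : PowerSeries K} {a b : ℤ → K} (hna : ∀ k < 0, a k = 0)
    (ha : ∀ k : ℕ, PowerSeries.coeff k S = a k) (hnb : ∀ k < 0, b k = 0)
    (hb : ∀ k : ℕ, PowerSeries.coeff k T = b k) :
    varL K ^ (max m 0) * (varL K ^ (-m) * toLaurent K S - toLaurent K T) =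
      toLaurent K (PowerSeries.mk fun j : ℕ => a (j + min m 0) - b (j - max m 0)) := by
  have e1 : varL K ^ (max m 0) * varL K ^ (-m) = varL K ^ (-min m 0).toNat := by
    rw [← zpow_add₀ varL_ne_zero, ← zpow_natCast]; congr 1; omega
  have e2 : varL K ^ (max m 0) = varL K ^ (max m 0).toNat := by
    rw [← zpow_natCast]; congr 1; omega
  have e3 : (PowerSeries.mk fun j : ℕ => a (j + min m 0) - b (j - max m 0)) =
      PowerSeries.X ^ (-min m 0).toNat * S - PowerSeries.X ^ (max m 0).toNat * T := by
    ext j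
    rw [PowerSeries.coeff_mk, map_sub, coeff_X_pow_mul_of_int hna ha,
      coeff_X_pow_mul_of_int hnb hb]
    congr 2 <;> omega
  rw [mul_sub, ← mul_assoc, e1, e2, e3, map_sub, map_mul, map_mul, map_pow, map_pow, toLaurent_X]

/-- The Casoratian contributes 1/(x/c;q)_∞. If m ≤ n, Jackson's identity applied to the two
functions at (m,n) extracts (q^{n-m}x/c;q)_∞ from both terms, leaving (x/c;q)_{n-m} uncancelled. If
m > n, it is applied to the two functions at (0,0) instead, and the whole product cancels. -/
theorem laurentU_eq_series (h : Generic c q) (m n : ℤ) :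
    polyL K (denomPoly c q (n - m).toNat) * varL K ^ (max m 0 - 1) *
      (constL K ((1 - c) * (c - q)) * laurentU c q m n) =
      toLaurent K (PowerSeries.mk fun j : ℕ => coeffP m n c q j) := by
  have hq := h.q_ne
  have hc := h.c_ne
  have hw : constL K ((1 - c) * (c - q)) ≠ 0 := by
    rw [map_ne_zero]; exact mul_ne_zero h.one_sub_ne' h.ne
  have hE : ∀ t, toLaurent K (formalE q t) ≠ 0 := fun t => by
    rw [Ne, map_eq_zero_iff _ toLaurent_injective]; exact formalE_ne_zero _ _
  have hD := congrArg (toLaurent K) (formalE_eq_denomPoly_mul h (n - m).toNat)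
  rw [map_mul, ← polyL_apply] at hD
  have hDne : polyL K (denomPoly c q (n - m).toNat) ≠ 0 := by
    intro h0
    rw [h0, zero_mul] at hD
    exact hE _ hD
  set W := toLaurent K (formalPhi c q 1) * (constL K (secondCoeff c q m n) * varL K ^ (-m) *
        toLaurent K (formalPhi (q ^ (2 - m) / c) q (q ^ (n + 2 - 2 * m) / c ^ 2)))
      - toLaurent K (formalPhi (q ^ 2 / c) q (q ^ 2 / c ^ 2)) *
        toLaurent K (formalPhi (c * q ^ m) q (q ^ n)) with hW
  have step : polyL K (denomPoly c q (n - m).toNat) * varL K ^ (max m 0 - 1) *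
      (constL K ((1 - c) * (c - q)) * laurentU c q m n) =
      varL K ^ (max m 0) * (toLaurent K (formalE q (q ^ (n - m).toNat / c)))⁻¹ * W := by
    rw [laurentU, ← hW, hD, zpow_sub_one₀ varL_ne_zero]
    have := hE (q ^ (n - m).toNat / c)
    have := varL_ne_zero (K := K)
    field_simp
  rw [step]
  by_cases hmn : m ≤ n
  · have eN : q ^ (n - m).toNat = q ^ (n - m) := by
      rw [← zpow_natCast]; congr 1; omega
    have f1 : formalPhi (c * q ^ m) q (q ^ n) =
        formalE q (q ^ (n - m) / c) * formalJ (c * q ^ m) q (q ^ (n - m) / c) := by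
      rw [← formalPhi_eq (h.mul_zpow m)]
      congr 1
      field_simp
      rw [← zpow_add₀ hq]; congr 1; ring
    have f2 : formalPhi (q ^ (2 - m) / c) q (q ^ (n + 2 - 2 * m) / c ^ 2) =
        formalE q (q ^ (n - m) / c) * formalJ (q ^ (2 - m) / c) q (q ^ (n - m) / c) := by
      rw [← formalPhi_eq (h.zpow_div (2 - m))]
      congr 1
      field_simp
      rw [← zpow_add₀ hq]; congr 1; ring
    have := varL_zpow_sub (m := m) (a := coeffA m n c q) (b := coeffB m n c q)
      (S := PowerSeries.C (secondCoeff c q m n) *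
        (formalPhi c q 1 * formalJ (q ^ (2 - m) / c) q (q ^ (n - m) / c)))
      (T := formalJ (c * q ^ m) q (q ^ (n - m) / c) * formalPhi (q ^ 2 / c) q (q ^ 2 / c ^ 2))
      (fun k hk => by rw [coeffA, if_pos hk])
      (fun k => by rw [PowerSeries.coeff_C_mul, coeff_eq_coeffA h])
      (fun k hk => by rw [coeffB, if_pos hk])
      (fun k => coeff_eq_coeffB h m n k)
    simp only [coeffP, if_pos hmn]
    rw [← this, hW, f1, f2, eN]
    have := hE (q ^ (n - m) / c)
    simp only [map_mul, toLaurent_C]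
    field_simp
  · have eN : (n - m).toNat = 0 := by omega
    have f1 : formalPhi c q 1 = formalE q (1 / c) * formalJ c q (1 / c) := by
      rw [← formalPhi_eq h, mul_one_div_cancel hc]
    have f2 : formalPhi (q ^ 2 / c) q (q ^ 2 / c ^ 2) =
        formalE q (1 / c) * formalJ (q ^ 2 / c) q (1 / c) := by
      rw [← formalPhi_eq h.sq_div]
      congr 1
      ring
    have := varL_zpow_sub (m := m) (a := coeffA' m n c q) (b := coeffB' m n c q)
      (S := PowerSeries.C (secondCoeff c q m n) *
        (formalJ c q (1 / c) * formalPhi (q ^ (2 - m) / c) q (q ^ (n + 2 - 2 * m) / c ^ 2)))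
      (T := formalPhi (c * q ^ m) q (q ^ n) * formalJ (q ^ 2 / c) q (1 / c))
      (fun k hk => by rw [coeffA', if_pos hk])
      (fun k => by rw [PowerSeries.coeff_C_mul, coeff_eq_coeffA' h])
      (fun k hk => by rw [coeffB', if_pos hk])
      (fun k => coeff_eq_coeffB' h m n k)
    simp only [coeffP, if_neg hmn]
    rw [← this, hW, f1, f2, eN, pow_zero]
    have := hE (1 / c)
    simp only [map_mul, toLaurent_C]
    field_simp

end SeriesIdentity

/-! ### Bounds for the poles and for the degree at infinity of U. -/

section Structure

variable {K : Type*} [Field K] {c q : K}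

/-- `(X/c; q)_N g` is `X^k` times a polynomial. -/
def HasPoles (c q : K) (k : ℤ) (N : ℕ) (g : LaurentSeries K) : Prop :=
  ∃ p : K[X], polyL K (denomPoly c q N) * g = varL K ^ k * polyL K p

namespace HasPoles
variable {k l : ℤ} {N M : ℕ} {g g' : LaurentSeries K}

theorem add (h : HasPoles c q k N g) (h' : HasPoles c q k N g') :
    HasPoles c q k N (g + g') := by
  obtain ⟨p, hp⟩ := h
  obtain ⟨p', hp'⟩ := h'
  exact ⟨p + p', by rw [mul_add, hp, hp', map_add]; ring⟩

theorem const_mul (h : HasPoles c q k N g) (a : K) : HasPoles c q k N (constL K a * g) := by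
  obtain ⟨p, hp⟩ := h
  exact ⟨Polynomial.C a * p, by rw [map_mul, polyL_C, mul_left_comm, hp]; ring⟩

theorem sub (h : HasPoles c q k N g) (h' : HasPoles c q k N g') :
    HasPoles c q k N (g - g') := by
  have := h.add (h'.const_mul (-1))
  rwa [map_neg, map_one, neg_one_mul, ← sub_eq_add_neg] at this

theorem mono (h : HasPoles c q k N g) (hk : l ≤ k) (hN : N ≤ M) : HasPoles c q l M g := by
  obtain ⟨p, hp⟩ := h
  have hd : denomPoly c q N ∣ denomPoly c q M :=
    Finset.prod_dvd_prod_of_subset _ _ _ (Finset.range_mono hN)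
  obtain ⟨r, hr⟩ := hd
  refine ⟨Polynomial.X ^ (k - l).toNat * p * r, ?_⟩
  rw [hr, map_mul, mul_right_comm, hp, map_mul, map_mul, map_pow, polyL_X, ← zpow_natCast,
    Int.toNat_of_nonneg (sub_nonneg.2 hk), zpow_sub₀ varL_ne_zero]
  have := zpow_ne_zero l (varL_ne_zero (K := K))
  field_simp

theorem varL_zpow_mul (h : HasPoles c q k N g) (l : ℤ) : HasPoles c q (l + k) N (varL K ^ l * g) := by
  obtain ⟨p, hp⟩ := h
  exact ⟨p, by rw [mul_left_comm, hp, zpow_add₀ varL_ne_zero, mul_assoc]⟩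

theorem varL_mul (h : HasPoles c q k N g) : HasPoles c q (k + 1) N (varL K * g) := by
  simpa [add_comm] using h.varL_zpow_mul 1

theorem of_varL_mul (h : HasPoles c q k N (varL K * g)) : HasPoles c q (k - 1) N g := by
  have := h.varL_zpow_mul (-1)
  rwa [zpow_neg_one, ← mul_assoc, inv_mul_cancel₀ varL_ne_zero, one_mul, neg_add_eq_sub] at this

theorem of_const_mul (h : HasPoles c q k N (constL K a * g)) (ha : a ≠ 0) :
    HasPoles c q k N g := by
  have := h.const_mul a⁻¹
  rwa [← mul_assoc, ← map_mul, inv_mul_cancel₀ ha, map_one, one_mul] at this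

theorem of_linear_mul (hc : c ≠ 0)
    (h : HasPoles c q k N ((constL K c - varL K * constL K q ^ N) * g)) :
    HasPoles c q k (N + 1) g := by
  obtain ⟨p, hp⟩ := h.const_mul c⁻¹
  refine ⟨p, ?_⟩
  have hi : constL K c⁻¹ * constL K c = 1 := by rw [← map_mul, inv_mul_cancel₀ hc, map_one]
  rw [← hp, denomPoly_succ]
  simp only [map_mul, map_sub, map_one, polyL_C, polyL_X, div_eq_mul_inv, map_pow]
  linear_combination (-polyL K (denomPoly c q N) * g) * hi

theorem one (c q : K) : HasPoles c q 0 0 1 := ⟨1, by simp [denomPoly]⟩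

theorem zero (c q : K) (k : ℤ) (N : ℕ) : HasPoles c q k N 0 := ⟨0, by simp⟩

end HasPoles

theorem constL_one_sub (c q : K) (m : ℤ) :
    1 - constL K c * constL K q ^ m = constL K (1 - c * q ^ m) := by
  simp [map_sub, map_mul, map_zpow₀]

theorem laurentU_one_zero (h : Generic c q) : laurentU c q 1 0 = constL K c := by
  have := (isContig_laurentU h).eq_sub 0 0
  rw [laurentU_zero, zero_add, laurentU_one h] at this
  simp at this
  linear_combination -this

/-- The relations are solved so that new poles are controlled: only the upward steps in row 1 divide
by c - xq^N, the next factor of (x/c;q) up to the constant c, and only the steps raising m ≥ 1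
divide by x. All other divisions are by constants. -/
theorem hasPoles_laurentU (h : Generic c q) (m n : ℤ) :
    HasPoles c q (1 - max m 0) (n - m).toNat (laurentU c q m n) := by
  have hY := isContig_laurentU h
  have hq := h.q_ne
  refine IsContig.lattice_induction
    (Q := fun m n => HasPoles c q (1 - max m 0) (n - m).toNat (laurentU c q m n))
    ?_ ?_ ?_ ?_ ?_ ?_ ?_ ?_ ?_ m n
  · simp only [laurentU_zero]; exact HasPoles.zero _ _ _ _
  · have := (HasPoles.one c q).const_mul c
    rw [mul_one, ← laurentU_one_zero h] at this
    exact this.mono (by omega) (by omega)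
  · simp only [laurentU_one h]
    exact (HasPoles.one c q).mono (by omega) (by omega)
  · intro n hn h1 h2
    have e := hY.three_term 1 n
    rw [sub_self, zpow_zero, mul_one] at e
    obtain ⟨N, rfl⟩ := Int.eq_ofNat_of_zero_le hn
    rw [zpow_natCast] at e
    -- Both terms are brought to exactly N factors, so that c - xq^N supplies factor number N + 1.
    have h1' := h1.mono (le_refl _) (show ((N : ℤ) - 1).toNat ≤ N by omega)
    have h2' := h2.mono (le_refl _) (show ((N : ℤ) + 1 - 1).toNat ≤ N by omega)
    have h3 := ((h2'.const_mul (1 + c)).sub h1')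
    rw [map_add, map_one, ← e] at h3
    exact (h3.of_linear_mul h.c_ne).mono (le_refl _) (by omega)
  · intro n hn h1 h2
    have e := hY.three_term 1 n
    rw [sub_self, zpow_zero, mul_one] at e
    have h2' := (h2.mono (le_refl _) (show (n + 2 - 1).toNat ≤ (n - 1).toNat by omega))
    have h3 := (((h1.mono (le_refl _) (show (n + 1 - 1).toNat ≤ (n - 1).toNat by omega)).const_mul
      (1 + c)).sub (h2'.const_mul c)).add
      ((h2'.varL_mul.const_mul (q ^ n)).mono (show 1 - max 1 0 ≤ _ by omega) (le_refl _))
    convert h3 using 1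
    simp only [map_add, map_one, map_zpow₀]
    linear_combination e
  · intro n hn h1 h2
    -- `sub_eq` is used because it displays the factor x required in row 0.
    have e := hY.sub_eq 0 n
    have h3 := (h1.mono (le_refl _) (show (n - 0).toNat ≤ (n + 1 - 0).toNat by omega)).const_mul
      (1 - c * q ^ (0 : ℤ))
    have h4 := ((h2 (n + 2)).varL_mul.mono (show 1 - max 0 0 ≤ 1 - max 1 0 + 1 by omega)
      (show (n + 2 - 1).toNat ≤ (n + 1 - 0).toNat by omega)).const_mul (q ^ n)
    refine HasPoles.of_const_mul (a := 1 - c * q ^ (0 : ℤ)) ?_ (h.one_sub_ne 0)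
    convert h3.sub h4 using 1
    rw [← constL_one_sub, map_zpow₀]
    rw [zero_add] at e
    linear_combination -e
  · intro n hn h1 h2
    have e := hY.sub_eq 0 n
    have h3 := (h1.mono (le_refl _) (show (n + 1 - 0).toNat ≤ (n - 0).toNat by omega)).const_mul
      (1 - c * q ^ (0 : ℤ))
    have h4 := (h2.varL_mul.mono (show 1 - max 0 0 ≤ 1 - max 1 0 + 1 by omega)
      (show (n + 2 - 1).toNat ≤ (n - 0).toNat by omega)).const_mul (q ^ n)
    refine HasPoles.of_const_mul (a := 1 - c * q ^ (0 : ℤ)) ?_ (h.one_sub_ne 0)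
    convert h3.add h4 using 1
    rw [← constL_one_sub, map_zpow₀]
    rw [zero_add] at e
    linear_combination e
  · intro m n hm h1 h2
    have e := hY.eq_sub m n
    refine HasPoles.of_const_mul (a := 1 - c * q ^ m) ?_ (h.one_sub_ne m)
    rw [← constL_one_sub, e]
    have h3 := h1.mono (show 1 - max m 0 ≤ _ by omega)
      (show (n - (m + 1)).toNat ≤ (n - m).toNat by omega)
    have h4 := h2.mono (show 1 - max m 0 ≤ _ by omega)
      (show (n + 1 - (m + 1)).toNat ≤ (n - m).toNat by omega)
    convert h3.sub (h4.const_mul (c * q ^ m)) using 2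
    simp
  · intro m n hm h1 h2
    have e := hY.sub_eq m n
    have h3 := (h1.mono (le_refl _) (show (n - m).toNat ≤ (n + 1 - m).toNat by omega)).sub h2
    have h4 := h3.const_mul (1 - c * q ^ m)
    rw [← constL_one_sub, e, mul_assoc] at h4
    have h5 := h4.of_varL_mul
    rw [← map_zpow₀] at h5
    exact (h5.of_const_mul (zpow_ne_zero _ hq)).mono (by omega) (by omega)

/-- `g` is a rational function whose degree (at infinity) is at most `d`. -/
def HasDegreeLE (d : ℤ) (g : LaurentSeries K) : Prop :=
  ∃ a b : K[X], b ≠ 0 ∧ polyL K b * g = polyL K a ∧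
    (a = 0 ∨ (a.natDegree : ℤ) ≤ b.natDegree + d)

namespace HasDegreeLE
variable {d e : ℤ} {g g' : LaurentSeries K}

theorem add (h : HasDegreeLE d g) (h' : HasDegreeLE d g') : HasDegreeLE d (g + g') := by
  obtain ⟨a, b, hb, hab, hd⟩ := h
  obtain ⟨a', b', hb', hab', hd'⟩ := h'
  refine ⟨a * b' + a' * b, b * b', mul_ne_zero hb hb', ?_, ?_⟩
  · simp only [map_mul, map_add]
    linear_combination polyL K b' * hab + polyL K b * hab'
  · by_cases h0 : a * b' + a' * b = 0
    · exact Or.inl h0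
    right
    rw [Polynomial.natDegree_mul hb hb']
    have h1 := Polynomial.natDegree_add_le (a * b') (a' * b)
    by_cases ha : a = 0
    · by_cases ha' : a' = 0
      · simp [ha, ha'] at h0
      · have := hd'.resolve_left ha'
        simp only [ha, zero_mul, zero_add, Polynomial.natDegree_mul ha' hb]
        push_cast; omega
    · have hd1 := hd.resolve_left ha
      rw [Polynomial.natDegree_mul ha hb'] at h1
      by_cases ha' : a' = 0
      · simp only [ha', zero_mul, add_zero, Polynomial.natDegree_mul ha hb']
        push_cast; omega
      · have := hd'.resolve_left ha'
        rw [Polynomial.natDegree_mul ha' hb] at h1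
        push_cast; omega

theorem mono (h : HasDegreeLE d g) (hde : d ≤ e) : HasDegreeLE e g := by
  obtain ⟨a, b, hb, hab, hd⟩ := h
  exact ⟨a, b, hb, hab, hd.imp_right fun h => by omega⟩

theorem const_mul (h : HasDegreeLE d g) (r : K) : HasDegreeLE d (constL K r * g) := by
  obtain ⟨a, b, hb, hab, hd⟩ := h
  refine ⟨Polynomial.C r * a, b, hb, by rw [map_mul, polyL_C, mul_left_comm, hab], ?_⟩
  rcases hd with rfl | hd
  · exact Or.inl (mul_zero _)
  · right
    have := Polynomial.natDegree_C_mul_le r a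
    omega

theorem sub (h : HasDegreeLE d g) (h' : HasDegreeLE d g') : HasDegreeLE d (g - g') := by
  have := h.add (h'.const_mul (-1))
  rwa [map_neg, map_one, neg_one_mul, ← sub_eq_add_neg] at this

theorem of_const_mul {r : K} (h : HasDegreeLE d (constL K r * g)) (hr : r ≠ 0) :
    HasDegreeLE d g := by
  have := h.const_mul r⁻¹
  rwa [← mul_assoc, ← map_mul, inv_mul_cancel₀ hr, map_one, one_mul] at this

theorem varL_mul (h : HasDegreeLE d g) : HasDegreeLE (d + 1) (varL K * g) := by
  obtain ⟨a, b, hb, hab, hd⟩ := h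
  refine ⟨Polynomial.X * a, b, hb, by rw [map_mul, polyL_X, mul_left_comm, hab], ?_⟩
  rcases hd with rfl | hd
  · exact Or.inl (mul_zero _)
  · by_cases ha : a = 0
    · exact Or.inl (by rw [ha, mul_zero])
    right
    rw [Polynomial.natDegree_X_mul ha]
    push_cast; omega

theorem of_linear_mul {r s : K} (hs : s ≠ 0)
    (h : HasDegreeLE d ((constL K r - varL K * constL K s) * g)) : HasDegreeLE (d - 1) g := by
  obtain ⟨a, b, hb, hab, hd⟩ := h
  have hdeg : (Polynomial.C (-s) * Polynomial.X + Polynomial.C r).natDegree = 1 :=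
    Polynomial.natDegree_linear (neg_ne_zero.2 hs)
  have hne : Polynomial.C (-s) * Polynomial.X + Polynomial.C r ≠ 0 := by
    intro h0; rw [h0] at hdeg; simp at hdeg
  refine ⟨a, b * (Polynomial.C (-s) * Polynomial.X + Polynomial.C r), mul_ne_zero hb hne, ?_, ?_⟩
  · rw [← hab]
    simp only [map_mul, map_add, polyL_C, polyL_X, map_neg]
    ring
  · rw [Polynomial.natDegree_mul hb hne, hdeg]
    exact hd.imp_right fun h => by push_cast; omega

theorem of_varL_mul (h : HasDegreeLE d (varL K * g)) : HasDegreeLE (d - 1) g := by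
  refine of_linear_mul (r := 0) (s := -1) (by simp) ?_
  simpa using h

theorem const (r : K) : HasDegreeLE 0 (constL K r) :=
  ⟨Polynomial.C r, 1, one_ne_zero, by rw [map_one, one_mul, polyL_C], Or.inr (by simp)⟩

end HasDegreeLE

/-- Raising n by 2 divides by one linear factor in x, either c - xq^n in row 1 or x above it, which
accounts for ⌊n/2⌋. -/
theorem hasDegreeLE_laurentU (h : Generic c q) (m n : ℤ) :
    HasDegreeLE (-(n / 2)) (laurentU c q m n) := by
  have hY := isContig_laurentU h
  have hq := h.q_ne
  refine IsContig.lattice_induction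
    (Q := fun m n => HasDegreeLE (-(n / 2)) (laurentU c q m n))
    ?_ ?_ ?_ ?_ ?_ ?_ ?_ ?_ ?_ m n
  · simpa [laurentU_zero] using HasDegreeLE.const (0 : K)
  · simpa [laurentU_one_zero h] using HasDegreeLE.const c
  · simpa [laurentU_one h] using HasDegreeLE.const (1 : K)
  · intro n hn h1 h2
    have e := hY.three_term 1 n
    rw [sub_self, zpow_zero, mul_one] at e
    have h3 := ((h2.mono (show _ ≤ -(n / 2) by omega)).const_mul (1 + c)).sub h1
    rw [map_add, map_one, ← e, ← map_zpow₀] at h3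
    exact (h3.of_linear_mul (zpow_ne_zero _ hq)).mono (by omega)
  · intro n hn h1 h2
    have e := hY.three_term 1 n
    rw [sub_self, zpow_zero, mul_one] at e
    have h3 := (((h1.mono (show _ ≤ -(n / 2) by omega)).const_mul (1 + c)).sub
      ((h2.mono (show _ ≤ -(n / 2) by omega)).const_mul c)).add
      ((h2.varL_mul.const_mul (q ^ n)).mono (show _ ≤ -(n / 2) by omega))
    convert h3 using 1
    simp only [map_add, map_one, map_zpow₀]
    linear_combination e
  · intro n hn h1 h2
    -- Here `sub_eq` would lose one degree for odd n, since it passes through the value at n;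
    -- `eq_sub` takes both terms from row 1 without a factor x.
    have e := hY.eq_sub 0 (n + 1)
    refine HasDegreeLE.of_const_mul (r := 1 - c * q ^ (0 : ℤ)) ?_ (h.one_sub_ne 0)
    rw [← constL_one_sub, e]
    have h3 := h2 (n + 1)
    have h4 := (h2 (n + 1 + 1)).mono (show _ ≤ -((n + 1) / 2) by omega)
    convert h3.sub (h4.const_mul c) using 2
    all_goals simp
  · intro n hn h1 h2
    have e := hY.sub_eq 0 n
    have h3 := (h1.mono (show _ ≤ -(n / 2) by omega)).const_mul (1 - c * q ^ (0 : ℤ))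
    have h4 := (h2.varL_mul.mono (show _ ≤ -(n / 2) by omega)).const_mul (q ^ n)
    refine HasDegreeLE.of_const_mul (r := 1 - c * q ^ (0 : ℤ)) ?_ (h.one_sub_ne 0)
    convert h3.add h4 using 1
    rw [← constL_one_sub, map_zpow₀]
    rw [zero_add] at e
    linear_combination e
  · intro m n hm h1 h2
    have e := hY.eq_sub m n
    refine HasDegreeLE.of_const_mul (r := 1 - c * q ^ m) ?_ (h.one_sub_ne m)
    rw [← constL_one_sub, e]
    have h4 := h2.mono (show _ ≤ -(n / 2) by omega)
    convert h1.sub (h4.const_mul (c * q ^ m)) using 2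
    simp
  · intro m n hm h1 h2
    have e := hY.sub_eq m n
    have h3 := (h1.sub (h2.mono (show _ ≤ -(n / 2) by omega))).const_mul (1 - c * q ^ m)
    rw [← constL_one_sub, e, mul_assoc] at h3
    have h5 := h3.of_varL_mul
    rw [← map_zpow₀] at h5
    exact (h5.of_const_mul (zpow_ne_zero _ hq)).mono (by omega)

end Structure

/-! ### The polynomial P^{(0,1)}, and specialization of the Laurent variable. -/

section ClosedForm

variable {K : Type*} [Field K] {c q x : K}

theorem coeff_P01 (m n : ℤ) (c q : K) (i : ℕ) :
    (P01 m n c q).coeff i = if i < (degBound m n + 1).toNat then coeffP m n c q i else 0 := by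
  have : P01 m n c q = ∑ j ∈ Finset.range (degBound m n + 1).toNat,
    Polynomial.C (coeffP m n c q j) * Polynomial.X ^ j := rfl
  rw [this, Polynomial.finsetSum_coeff]
  simp only [Polynomial.coeff_C_mul_X_pow]
  simp

theorem natDegree_denomPoly_le (c q : K) (N : ℕ) : (denomPoly c q N).natDegree ≤ N := by
  refine (Polynomial.natDegree_prod_le _ _).trans ?_
  refine (Finset.sum_le_card_nsmul _ _ 1 fun i _ => ?_).trans (by simp)
  compute_degree

theorem denomPoly_ne_zero (c q : K) (N : ℕ) : denomPoly c q N ≠ 0 := by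
  intro h
  have := congrArg (Polynomial.eval 0) h
  simp [denomPoly, Polynomial.eval_prod] at this

/-- The pole bound makes the series of `laurentU_eq_series` a polynomial, and the degree bound makes
its coefficients beyond e vanish. Truncation in `P01` therefore loses nothing. -/
theorem laurentU_eq_P01 (h : Generic c q) (m n : ℤ) :
    polyL K (denomPoly c q (n - m).toNat) * varL K ^ (max m 0 - 1) *
      (constL K ((1 - c) * (c - q)) * laurentU c q m n) = polyL K (P01 m n c q) := by
  obtain ⟨p, hp⟩ := hasPoles_laurentU h m n
  obtain ⟨a, b, hb, hab, hd⟩ := hasDegreeLE_laurentU h m n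
  have hx := varL_ne_zero (K := K)
  have e1 : polyL K (denomPoly c q (n - m).toNat) * varL K ^ (max m 0 - 1) *
      (constL K ((1 - c) * (c - q)) * laurentU c q m n) =
      polyL K (Polynomial.C ((1 - c) * (c - q)) * p) := by
    rw [map_mul (polyL K), polyL_C, ← neg_sub 1 (max m 0), zpow_neg]
    have := zpow_ne_zero (1 - max m 0) hx
    field_simp
    linear_combination constL K ((1 - c) * (c - q)) * hp
  have e2 := laurentU_eq_series h m n
  rw [e1, polyL_apply] at e2
  have e3 := toLaurent_injective e2
  have hcoeff : ∀ j : ℕ, (Polynomial.C ((1 - c) * (c - q)) * p).coeff j = coeffP m n c q j := by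
    intro j
    rw [← Polynomial.coeff_coe, e3, PowerSeries.coeff_mk]
  have hdeg : p = 0 ∨ (p.natDegree : ℤ) ≤ degBound m n := by
    have e4 : polyL K (Polynomial.X ^ (1 - max m 0).toNat * (b * p)) =
        polyL K (Polynomial.X ^ (max m 0 - 1).toNat * (denomPoly c q (n - m).toNat * a)) := by
      simp only [map_mul, map_pow, polyL_X, ← hab]
      rw [mul_left_comm (polyL K (denomPoly _ _ _)) (polyL K b), hp, ← zpow_natCast, ← zpow_natCast]
      have : varL K ^ (((1 - max m 0).toNat : ℕ) : ℤ) =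
          varL K ^ (((max m 0 - 1).toNat : ℕ) : ℤ) * varL K ^ (1 - max m 0) := by
        rw [← zpow_add₀ hx]; congr 1; omega
      rw [this]; ring
    have e5 := polyL_injective e4
    by_cases hp0 : p = 0
    · exact Or.inl hp0
    right
    have ha : a ≠ 0 := by
      rintro rfl
      rw [mul_zero, mul_zero] at e5
      simp [hb, hp0] at e5
    have e6 := congrArg Polynomial.natDegree e5
    have hD := denomPoly_ne_zero c q (n - m).toNat
    rw [Polynomial.natDegree_mul (pow_ne_zero _ Polynomial.X_ne_zero) (mul_ne_zero hb hp0),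
      Polynomial.natDegree_mul (pow_ne_zero _ Polynomial.X_ne_zero) (mul_ne_zero hD ha),
      Polynomial.natDegree_mul hb hp0, Polynomial.natDegree_mul hD ha, Polynomial.natDegree_X_pow,
      Polynomial.natDegree_X_pow] at e6
    have e7 := natDegree_denomPoly_le c q (n - m).toNat
    have e8 := hd.resolve_left ha
    -- The bound max(n-m,0) + max(m,0) - 1 - ⌊n/2⌋ equals e, because max(n-m,0) + max(m,0) = n -
    -- min{m,n,n-m,0} and n - ⌊n/2⌋ = ⌊(n+1)/2⌋.
    simp only [degBound]
    omega
  rw [e1]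
  congr 1
  ext j
  rw [coeff_P01, hcoeff]
  split_ifs with hj
  · rfl
  · rw [← hcoeff, Polynomial.coeff_C_mul]
    rcases hdeg with rfl | hdeg
    · simp
    · rw [Polynomial.coeff_eq_zero_of_natDegree_lt (by omega), mul_zero]

/-- The Laurent series `g` is the expansion of a rational function with value `v` at `x`. -/
def EvalsTo (x : K) (g : LaurentSeries K) (v : K) : Prop :=
  ∃ a b : K[X], b.eval x ≠ 0 ∧ polyL K b * g = polyL K a ∧ b.eval x * v = a.eval x

namespace EvalsTo
variable {g g' : LaurentSeries K} {v v' : K}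

theorem poly (x : K) (p : K[X]) : EvalsTo x (polyL K p) (p.eval x) :=
  ⟨p, 1, by simp, by simp, by simp⟩

theorem const (x a : K) : EvalsTo x (constL K a) a := by
  simpa [polyL_C] using poly x (Polynomial.C a)

theorem var (x : K) : EvalsTo x (varL K) x := by
  simpa [polyL_X] using poly x Polynomial.X

theorem sub (h : EvalsTo x g v) (h' : EvalsTo x g' v') : EvalsTo x (g - g') (v - v') := by
  obtain ⟨a, b, hb, h1, h2⟩ := h
  obtain ⟨a', b', hb', h1', h2'⟩ := h'
  refine ⟨a * b' - a' * b, b * b', by simp [hb, hb'], ?_, ?_⟩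
  · simp only [map_mul, map_sub]
    linear_combination polyL K b' * h1 - polyL K b * h1'
  · simp only [Polynomial.eval_mul, Polynomial.eval_sub]
    linear_combination b'.eval x * h2 - b.eval x * h2'

theorem mul (h : EvalsTo x g v) (h' : EvalsTo x g' v') : EvalsTo x (g * g') (v * v') := by
  obtain ⟨a, b, hb, h1, h2⟩ := h
  obtain ⟨a', b', hb', h1', h2'⟩ := h'
  refine ⟨a * a', b * b', by simp [hb, hb'], ?_, ?_⟩
  · simp only [map_mul, ← h1, ← h1']; ring
  · simp only [Polynomial.eval_mul, ← h2, ← h2']; ring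

theorem inv (h : EvalsTo x g v) (hv : v ≠ 0) : EvalsTo x g⁻¹ v⁻¹ := by
  obtain ⟨a, b, hb, h1, h2⟩ := h
  have ha : a.eval x ≠ 0 := h2 ▸ mul_ne_zero hb hv
  have hg : g ≠ 0 := by
    rintro rfl
    rw [mul_zero] at h1
    have := polyL_injective (h1.symm.trans (map_zero _).symm)
    simp [this] at ha
  refine ⟨b, a, ha, ?_, ?_⟩
  · rw [← h1, mul_inv_cancel_right₀ hg]
  · rw [← h2, mul_inv_cancel_right₀ hv]

theorem zpow (h : EvalsTo x g v) (hv : v ≠ 0) (k : ℤ) : EvalsTo x (g ^ k) (v ^ k) := by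
  have hpow : ∀ j : ℕ, EvalsTo x (g ^ j) (v ^ j) := by
    intro j
    induction j with
    | zero => simpa using const x 1
    | succ j ih => rw [pow_succ, pow_succ]; exact ih.mul h
  obtain ⟨j, rfl | rfl⟩ := k.eq_nat_or_neg
  · simpa using hpow j
  · simpa using (hpow j).inv (pow_ne_zero _ hv)

theorem unique (h : EvalsTo x g v) (h' : EvalsTo x g v') : v = v' := by
  obtain ⟨a, b, hb, h1, h2⟩ := h
  obtain ⟨a', b', hb', h1', h2'⟩ := h'
  have e : polyL K (a * b') = polyL K (a' * b) := by
    simp only [map_mul, ← h1, ← h1']; ring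
  have e' := congrArg (Polynomial.eval x) (polyL_injective e)
  simp only [Polynomial.eval_mul, ← h2, ← h2'] at e'
  have := mul_ne_zero hb hb'
  apply mul_left_cancel₀ this
  linear_combination e'

end EvalsTo

/-- The closed form of the coefficient `U(m, n; c, x; q)`. -/
noncomputable def closedU (c q x : K) (m n : ℤ) : K :=
  -(1 / ((q - c) * (1 - c))) * (x ^ (1 - max m 0) / qPoch (x / c) q (max (n - m) 0)) *
    (P01 m n c q).eval x

theorem eval_denomPoly (c q x : K) (k : ℤ) :
    (denomPoly c q k.toNat).eval x = qPoch (x / c) q (max k 0) := by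
  rw [← Int.toNat_eq_max, qPoch_natCast, denomPoly, Polynomial.eval_prod]
  refine Finset.prod_congr rfl fun i _ => ?_
  simp; ring

theorem evalsTo_laurentU (h : Generic c q) (hx : x ≠ 0) (hcx : ∀ k l : ℤ, c * q ^ k - x * q ^ l ≠ 0)
    (m n : ℤ) : EvalsTo x (laurentU c q m n) (closedU c q x m n) := by
  have hD : qPoch (x / c) q (max (n - m) 0) ≠ 0 := by
    rw [← Int.toNat_eq_max, qPoch_natCast, Finset.prod_ne_zero_iff]
    intro i _ h0
    apply hcx 0 i
    have hc := h.c_ne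
    field_simp at h0
    rw [zpow_zero, zpow_natCast]
    linear_combination h0
  have hw : (1 - c) * (c - q) ≠ 0 := mul_ne_zero h.one_sub_ne' h.ne
  have hw' : constL K ((1 - c) * (c - q)) ≠ 0 := by rwa [map_ne_zero]
  have hE := eval_denomPoly c q x (n - m)
  have hDL : polyL K (denomPoly c q (n - m).toNat) ≠ 0 := by
    rw [Ne, map_eq_zero_iff _ polyL_injective]; exact denomPoly_ne_zero _ _ _
  have key := ((((EvalsTo.const x ((1 - c) * (c - q))).inv hw).mul
    ((EvalsTo.var x).zpow hx (1 - max m 0))).mul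
    ((EvalsTo.poly x (denomPoly c q (n - m).toNat)).inv (hE ▸ hD))).mul
    (EvalsTo.poly x (P01 m n c q))
  rw [← laurentU_eq_P01 h] at key
  convert key using 1
  · have e : varL K ^ (1 - max m 0) * varL K ^ (max m 0 - 1) = 1 := by
      rw [← zpow_add₀ varL_ne_zero, ← zpow_zero (varL K)]; congr 1; ring
    rw [mul_assoc (polyL K _) , mul_assoc _ (polyL K _)⁻¹, inv_mul_cancel_left₀ hDL]
    have e2 := inv_mul_cancel₀ hw'
    linear_combination (-laurentU c q m n) * e2 - ((constL K ((1 - c) * (c - q)))⁻¹ *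
      constL K ((1 - c) * (c - q)) * laurentU c q m n) * e
  · rw [hE, closedU]
    have h1 := h.one_sub_ne'
    have h2 := h.ne
    have h3 : q - c ≠ 0 := by rw [← neg_sub]; exact neg_ne_zero.2 h2
    field_simp
    ring

/-- Evaluation at x respects the operations and is single-valued, so the relations of `laurentU`
descend to its values. -/
theorem isContig_closedU (h : Generic c q) (hx : x ≠ 0)
    (hcx : ∀ k l : ℤ, c * q ^ k - x * q ^ l ≠ 0) : IsContig c q x (closedU c q x) where
  sub_eq m n := by
    have hY := isContig_laurentU h
    have e := evalsTo_laurentU h hx hcx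
    have hr : EvalsTo x (1 - constL K c * constL K q ^ m) (1 - c * q ^ m) := by
      rw [constL_one_sub]; exact EvalsTo.const _ _
    have h1 := hr.mul ((e m n).sub (e m (n + 1)))
    have h2 := ((EvalsTo.var x).mul ((EvalsTo.const x q).zpow h.q_ne n)).mul (e (m + 1) (n + 2))
    rw [hY.sub_eq] at h1
    exact h1.unique h2
  eq_sub m n := by
    have hY := isContig_laurentU h
    have e := evalsTo_laurentU h hx hcx
    have hr : EvalsTo x (1 - constL K c * constL K q ^ m) (1 - c * q ^ m) := by
      rw [constL_one_sub]; exact EvalsTo.const _ _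
    have h1 := hr.mul (e m n)
    have h2 := (e (m + 1) n).sub
      (((EvalsTo.const x c).mul ((EvalsTo.const x q).zpow h.q_ne m)).mul (e (m + 1) (n + 1)))
    rw [hY.eq_sub] at h1
    exact h1.unique h2

theorem closedU_zero (h : Generic c q) (hx : x ≠ 0)
    (hcx : ∀ k l : ℤ, c * q ^ k - x * q ^ l ≠ 0) : closedU c q x 0 0 = 0 := by
  have := evalsTo_laurentU h hx hcx 0 0
  rw [laurentU_zero, ← map_zero (constL K)] at this
  exact this.unique (EvalsTo.const x 0)

theorem closedU_one (h : Generic c q) (hx : x ≠ 0)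
    (hcx : ∀ k l : ℤ, c * q ^ k - x * q ^ l ≠ 0) : closedU c q x 1 1 = 1 := by
  have := evalsTo_laurentU h hx hcx 1 1
  rw [laurentU_one h, ← map_one (constL K)] at this
  exact this.unique (EvalsTo.const x 1)

/-- The coefficients of `P01` are rational in `c` and `q`. -/
theorem coeff_P01_mem (m n : ℤ) (c q : K) (F : Subfield K) (hc : c ∈ F) (hq : q ∈ F) (i : ℕ) :
    (P01 m n c q).coeff i ∈ F := by
  have hP : ∀ a ∈ F, ∀ j : ℤ, qPoch a q j ∈ F := by
    intro a ha j
    cases j with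
    | ofNat j =>
      exact F.prod_mem fun i _ => F.sub_mem F.one_mem (F.mul_mem ha (F.pow_mem hq i))
    | negSucc j =>
      exact F.inv_mem (F.prod_mem fun i _ => F.sub_mem F.one_mem
        (F.mul_mem (F.mul_mem ha (F.zpow_mem hq _)) (F.pow_mem hq i)))
  have hphi : ∀ (N : ℕ) (b c' z : K), b ∈ F → c' ∈ F → z ∈ F → phi21 N b c' q z ∈ F := by
    intro N b c' z hb hc' hz
    exact F.sum_mem fun i _ => F.mul_mem (F.div_mem
      (F.mul_mem (hP _ (F.zpow_mem hq _) _) (hP _ hb _))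
      (F.mul_mem (hP _ hq _) (hP _ hc' _))) (F.pow_mem hz _)
  have hD : q ^ 2 / c ∈ F := F.div_mem (F.pow_mem hq 2) hc
  rw [coeff_P01]
  split_ifs
  · unfold coeffP coeffA coeffB coeffA' coeffB'
    have hA : ∀ (m n j k l r: ℤ) (N : ℕ) (z : ℤ), qPoch c q m / (qPoch q q j * qPoch (q ^ 2 / c) q k)
      * c ^ l * q ^ r * phi21 N (c * q ^ n) c q (q ^ z) ∈ F := fun m n j k l r N z =>
        F.mul_mem (F.mul_mem (F.mul_mem (F.div_mem (hP _ hc _) (F.mul_mem (hP _ hq _) (hP _ hD _)))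
          (F.zpow_mem hc _)) (F.zpow_mem hq _))
          (hphi _ _ _ _ (F.mul_mem hc (F.zpow_mem hq _)) hc (F.zpow_mem hq _))
    have hB : ∀ (j k l n m : ℤ) (N : ℕ) (z : ℤ), 1 / (qPoch q q j * qPoch (q ^ 2 / c) q k)
      * c ^ l * phi21 N (c * q ^ n) (c * q ^ m) q (q ^ z) ∈ F := fun j k l n m N z =>
        F.mul_mem (F.mul_mem (F.div_mem F.one_mem (F.mul_mem (hP _ hq _) (hP _ hD _)))
          (F.zpow_mem hc _))
          (hphi _ _ _ _ (F.mul_mem hc (F.zpow_mem hq _)) (F.mul_mem hc (F.zpow_mem hq _))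
            (F.zpow_mem hq _))
    split_ifs
    all_goals refine F.sub_mem ?_ ?_
    all_goals first | exact F.zero_mem | exact hA _ _ _ _ _ _ _ _ | exact hB _ _ _ _ _ _ _ |
      (rw [mul_right_comm]; exact F.mul_mem (hB _ _ _ _ _ _ _) (F.zpow_mem hq _))
  · exact F.zero_mem

end ClosedForm

/-! ### Convergence, joint continuity and contiguity of ₀φ₁ over ℂ. -/

section Analytic

open Filter Topology

theorem phi01_eq_tsum (c q x : ℂ) :
    phi01 c q x = ∑' j : ℕ, PowerSeries.coeff j (formalPhi c q x) := by
  refine tsum_congr fun j => ?_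
  rw [formalPhi, PowerSeries.coeff_mk]
  congr 2
  rw [mul_pow, ← pow_mul, ← pow_mul, mul_comm j 2, pow_mul, neg_one_sq, one_pow, one_mul,
    Nat.choose_two_right, Nat.div_mul_cancel (Nat.even_mul_pred_self j).two_dvd]

theorem LowerOK.one_sub_ne {b q : ℂ} (h : LowerOK b q) (i : ℕ) : 1 - b * q ^ i ≠ 0 := by
  intro h0
  apply h i
  rw [zpow_neg, zpow_natCast, eq_comm, inv_eq_iff_eq_inv, ← one_div, eq_div_iff]
  · linear_combination -h0
  · rintro rfl; simp at h0

/-- For large i the product cq^i has modulus at most 1/2 uniformly near the point; the finitely many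
remaining factors are bounded below by continuity. -/
theorem eventually_le_norm_one_sub {c₀ q₀ : ℂ} (hq : ‖q₀‖ < 1) (h : ∀ i : ℕ, 1 - c₀ * q₀ ^ i ≠ 0) :
    ∃ δ : ℝ, 0 < δ ∧ ∀ᶠ p : ℂ × ℂ in 𝓝 (c₀, q₀), ∀ i : ℕ, δ ≤ ‖1 - p.1 * p.2 ^ i‖ := by
  obtain ⟨r, hr, hr1⟩ := exists_between hq
  have hr0 : 0 ≤ r := (norm_nonneg _).trans hr.le
  have hM : 0 < ‖c₀‖ + 1 := by positivity
  obtain ⟨I, hI⟩ := exists_pow_lt_of_lt_one (show 0 < 1 / (2 * (‖c₀‖ + 1)) by positivity) hr1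
  have e1 : ∀ᶠ p : ℂ × ℂ in 𝓝 (c₀, q₀), ‖p.2‖ < r :=
    (continuous_snd.norm.tendsto (c₀, q₀)).eventually_lt_const hr
  have e2 : ∀ᶠ p : ℂ × ℂ in 𝓝 (c₀, q₀), ‖p.1‖ < ‖c₀‖ + 1 :=
    (continuous_fst.norm.tendsto (c₀, q₀)).eventually_lt_const (lt_add_one _)
  have e3 : ∀ J : ℕ, ∃ δ : ℝ, 0 < δ ∧
      ∀ᶠ p : ℂ × ℂ in 𝓝 (c₀, q₀), ∀ i < J, δ ≤ ‖1 - p.1 * p.2 ^ i‖ := by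
    intro J
    induction J with
    | zero => exact ⟨1, one_pos, by simp⟩
    | succ J ih =>
      obtain ⟨δ, hδ, hJ⟩ := ih
      have hpos : 0 < ‖1 - c₀ * q₀ ^ J‖ := norm_pos_iff.2 (h J)
      have hc : Continuous fun p : ℂ × ℂ => ‖1 - p.1 * p.2 ^ J‖ := by fun_prop
      have e4 := (hc.tendsto (c₀, q₀)).eventually_const_lt (half_lt_self hpos)
      refine ⟨min δ (‖1 - c₀ * q₀ ^ J‖ / 2), lt_min hδ (half_pos hpos), ?_⟩
      filter_upwards [hJ, e4] with p h1 h2 i hi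
      rcases Nat.lt_succ_iff_lt_or_eq.1 hi with hi | rfl
      · exact (min_le_left _ _).trans (h1 i hi)
      · exact (min_le_right _ _).trans h2.le
  obtain ⟨δ, hδ, e4⟩ := e3 I
  refine ⟨min δ (1 / 2), lt_min hδ (by norm_num), ?_⟩
  filter_upwards [e1, e2, e4] with p h1 h2 h3 i
  by_cases hi : i < I
  · exact (min_le_left _ _).trans (h3 i hi)
  · refine (min_le_right _ _).trans ?_
    have h4 : ‖p.1 * p.2 ^ i‖ ≤ 1 / 2 := by
      rw [norm_mul, norm_pow]
      calc ‖p.1‖ * ‖p.2‖ ^ i ≤ (‖c₀‖ + 1) * r ^ I := by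
            refine mul_le_mul h2.le ?_ (by positivity) hM.le
            exact (pow_le_pow_left₀ (norm_nonneg _) h1.le i).trans
              (pow_le_pow_of_le_one hr0 hr1.le (not_lt.1 hi))
        _ ≤ (‖c₀‖ + 1) * (1 / (2 * (‖c₀‖ + 1))) := by gcongr
        _ = 1 / 2 := by field_simp
    have h5 := norm_sub_norm_le (1 : ℂ) (p.1 * p.2 ^ i)
    rw [norm_one] at h5
    linarith

theorem pow_le_norm_qPoch {a q : ℂ} {δ : ℝ} (hδ : 0 ≤ δ) (h : ∀ i : ℕ, δ ≤ ‖1 - a * q ^ i‖) (j : ℕ) :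
    δ ^ j ≤ ‖qPoch a q (j : ℤ)‖ := by
  rw [qPoch_natCast, norm_prod]
  calc δ ^ j = ∏ _i ∈ Finset.range j, δ := by simp
    _ ≤ _ := Finset.prod_le_prod (fun _ _ => hδ) fun i _ => h i

theorem summable_pow_mul_pow {r B : ℝ} (hr0 : 0 < r) (hr1 : r < 1) (hB : 0 < B) :
    Summable fun j : ℕ => r ^ (j * (j - 1)) * B ^ j := by
  refine summable_of_ratio_test_tendsto_lt_one (l := 0) one_pos
    (Eventually.of_forall fun j => by positivity) ?_
  have h1 : Tendsto (fun j : ℕ => (r ^ 2) ^ j * B) atTop (𝓝 (0 * B)) :=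
    (tendsto_pow_atTop_nhds_zero_of_lt_one (by positivity) (by nlinarith)).mul_const B
  rw [zero_mul] at h1
  refine h1.congr fun j => ?_
  rw [Real.norm_of_nonneg (by positivity), Real.norm_of_nonneg (by positivity), pow_mul_pred_succ,
    eq_div_iff (by positivity), ← pow_mul]
  ring

/-- The Gaussian factor r^{j(j-1)} with r < 1 outweighs the geometric growth caused by the
denominators. The local majorant yields both summability and joint continuity. -/
theorem formalPhi_dominated {c₀ q₀ : ℂ} (x₀ : ℂ) (hq : ‖q₀‖ < 1)
    (h : ∀ i : ℕ, 1 - c₀ * q₀ ^ i ≠ 0) :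
    ∃ u : ℕ → ℝ, Summable u ∧ ∀ᶠ p : ℂ × ℂ × ℂ in 𝓝 (c₀, q₀, x₀),
      ∀ j, ‖PowerSeries.coeff j (formalPhi p.1 p.2.1 p.2.2)‖ ≤ u j := by
  obtain ⟨r, hr, hr1⟩ := exists_between hq
  have hr0 : 0 < r := (norm_nonneg _).trans_lt hr
  obtain ⟨δ, hδ, e1⟩ := eventually_le_norm_one_sub hq h
  have h' : ∀ i : ℕ, 1 - q₀ * q₀ ^ i ≠ 0 := by
    intro i h0
    have h1 : ‖q₀ ^ (i + 1)‖ < 1 := by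
      rw [norm_pow]; exact pow_lt_one₀ (norm_nonneg _) hq (by omega)
    rw [pow_succ', ← sub_eq_zero.1 h0, norm_one] at h1
    exact lt_irrefl _ h1
  obtain ⟨δ', hδ', e2⟩ := eventually_le_norm_one_sub hq h'
  have c1 : Continuous fun p : ℂ × ℂ × ℂ => (p.1, p.2.1) := by fun_prop
  have c2 : Continuous fun p : ℂ × ℂ × ℂ => (p.2.1, p.2.1) := by fun_prop
  have c3 : Continuous fun p : ℂ × ℂ × ℂ => ‖p.2.1‖ := by fun_prop
  have c4 : Continuous fun p : ℂ × ℂ × ℂ => ‖p.2.2‖ := by fun_prop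
  have e1' := (c1.tendsto (c₀, q₀, x₀)).eventually e1
  have e2' := (c2.tendsto (c₀, q₀, x₀)).eventually e2
  have e3 := (c3.tendsto (c₀, q₀, x₀)).eventually_lt_const hr
  have e4 := (c4.tendsto (c₀, q₀, x₀)).eventually_lt_const (lt_add_one ‖x₀‖)
  refine ⟨fun j => r ^ (j * (j - 1)) * ((‖x₀‖ + 1) / (δ' * δ)) ^ j,
    summable_pow_mul_pow hr0 hr1 (by positivity), ?_⟩
  filter_upwards [e1', e2', e3, e4] with p h1 h2 h3 h4 j
  have h5 := pow_le_norm_qPoch hδ.le h1 j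
  have h6 := pow_le_norm_qPoch hδ'.le h2 j
  rw [formalPhi, PowerSeries.coeff_mk, norm_div, norm_mul, norm_mul, norm_pow, norm_pow, div_pow,
    mul_pow, ← mul_div_assoc]
  refine div_le_div₀ (by positivity) ?_ (by positivity) ?_
  · exact mul_le_mul (pow_le_pow_left₀ (norm_nonneg _) h3.le _)
      (pow_le_pow_left₀ (norm_nonneg _) h4.le _) (by positivity) (by positivity)
  · exact mul_le_mul h6 h5 (by positivity) (norm_nonneg _)

theorem summable_formalPhi {c q : ℂ} (x : ℂ) (hq : ‖q‖ < 1) (h : ∀ i : ℕ, 1 - c * q ^ i ≠ 0) :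
    Summable fun j => PowerSeries.coeff j (formalPhi c q x) := by
  obtain ⟨u, hu, e⟩ := formalPhi_dominated x hq h
  exact Summable.of_norm_bounded hu e.self_of_nhds

theorem continuousAt_phi01 {c q : ℂ} (x : ℂ) (hq : ‖q‖ < 1) (h : ∀ i : ℕ, 1 - c * q ^ i ≠ 0) :
    ContinuousAt (fun p : ℂ × ℂ × ℂ => phi01 p.1 p.2.1 p.2.2) (c, q, x) := by
  obtain ⟨u, hu, e⟩ := formalPhi_dominated x hq h
  simp only [phi01_eq_tsum]
  refine tendsto_tsum_of_dominated_convergence hu (fun j => ?_) e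
  have hq' : ∀ i : ℕ, 1 - q * q ^ i ≠ 0 := by
    intro i h0
    have h1 : ‖q ^ (i + 1)‖ < 1 := by
      rw [norm_pow]; exact pow_lt_one₀ (norm_nonneg _) hq (by omega)
    rw [pow_succ', ← sub_eq_zero.1 h0, norm_one] at h1
    exact lt_irrefl _ h1
  simp only [formalPhi, PowerSeries.coeff_mk, qPoch_natCast]
  refine ContinuousAt.div (by fun_prop) (by fun_prop) ?_
  exact mul_ne_zero (Finset.prod_ne_zero_iff.2 fun i _ => hq' i)
    (Finset.prod_ne_zero_iff.2 fun i _ => h i)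

theorem Generic.one_sub_pow_ne' {K : Type*} [Field K] {c q : K} (h : Generic c q) (i : ℕ) :
    1 - c * q ^ i ≠ 0 := by simpa using h.one_sub_ne i

theorem Generic.hasSum {c q : ℂ} (h : Generic c q) (hq : ‖q‖ < 1) (x : ℂ) :
    HasSum (fun j => PowerSeries.coeff j (formalPhi c q x)) (phi01 c q x) := by
  rw [phi01_eq_tsum]
  exact (summable_formalPhi x hq h.one_sub_pow_ne').hasSum

theorem hasSum_coeff_X_mul {F : PowerSeries ℂ} {s : ℂ}
    (h : HasSum (fun j => PowerSeries.coeff j F) s) :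
    HasSum (fun j => PowerSeries.coeff j (PowerSeries.X * F)) s := by
  rw [← hasSum_nat_add_iff' 1]
  simpa [PowerSeries.coeff_succ_X_mul] using h

theorem isContig_phi01 {c q : ℂ} (h : Generic c q) (hq : ‖q‖ < 1) (x : ℂ) :
    IsContig c q x fun m n => phi01 (c * q ^ m) q (x * q ^ n) where
  sub_eq m n := by
    have hm := h.mul_zpow m
    have hm' := h.mul_zpow (m + 1)
    have e := formalPhi_sub hm (x * q ^ n)
    rw [mul_assoc c, ← zpow_add_one₀ h.q_ne, mul_assoc x, ← zpow_add_one₀ h.q_ne, mul_assoc x,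
      ← zpow_natCast q 2, ← zpow_add₀ h.q_ne, mul_assoc (PowerSeries.C _)] at e
    have h1 := ((hm.hasSum hq (x * q ^ n)).sub (hm.hasSum hq (x * q ^ (n + 1)))).mul_left (1 - c * q ^ m)
    have h2 := (hasSum_coeff_X_mul (hm'.hasSum hq (x * q ^ (n + 2)))).mul_left (x * q ^ n)
    have e' : (fun j => (1 - c * q ^ m) * (PowerSeries.coeff j (formalPhi (c * q ^ m) q (x * q ^ n)) -
        PowerSeries.coeff j (formalPhi (c * q ^ m) q (x * q ^ (n + 1))))) = fun j => x * q ^ n *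
        PowerSeries.coeff j (PowerSeries.X * formalPhi (c * q ^ (m + 1)) q (x * q ^ (n + 2))) := by
      funext j
      have := congrArg (PowerSeries.coeff j) e
      rw [PowerSeries.coeff_C_mul, PowerSeries.coeff_C_mul, map_sub] at this
      exact_mod_cast this
    rw [e'] at h1
    exact h1.unique h2
  eq_sub m n := by
    have hm := h.mul_zpow m
    have hm' := h.mul_zpow (m + 1)
    have e := formalPhi_contig hm (x * q ^ n)
    rw [mul_assoc c, ← zpow_add_one₀ h.q_ne, mul_assoc x, ← zpow_add_one₀ h.q_ne] at e
    have h1 := (hm.hasSum hq (x * q ^ n)).mul_left (1 - c * q ^ m)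
    have h2 := (hm'.hasSum hq (x * q ^ n)).sub
      ((hm'.hasSum hq (x * q ^ (n + 1))).mul_left (c * q ^ m))
    have e' : (fun j => (1 - c * q ^ m) * PowerSeries.coeff j (formalPhi (c * q ^ m) q (x * q ^ n))) =
        fun j => PowerSeries.coeff j (formalPhi (c * q ^ (m + 1)) q (x * q ^ n)) -
        c * q ^ m * PowerSeries.coeff j (formalPhi (c * q ^ (m + 1)) q (x * q ^ (n + 1))) := by
      funext j
      have := congrArg (PowerSeries.coeff j) e
      rwa [PowerSeries.coeff_C_mul, map_sub, PowerSeries.coeff_C_mul] at this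
    rw [e'] at h1
    exact h1.unique h2

end Analytic

/-! ### Linear independence of the two basic series over ℂ[x]. -/

section Independence

open Filter Topology

/-- A combination of rapidly decreasing terms vanishes only if its coefficients do. -/
theorem eq_zero_of_ratio_tendsto {s r : ℕ → ℂ} (hs : ∀ k, s k ≠ 0)
    (hratio : Tendsto (fun k => s (k + 1) / s k) atTop (𝓝 0)) (L : ℕ)
    (h : ∀ᶠ N in atTop, ∑ k ∈ Finset.range L, r k * s (2 * N + 1 - k) = 0) :
    ∀ k < L, r k = 0 := by
  have hshift : ∀ e : ℕ, Tendsto (fun k => s (k + (e + 1)) / s k) atTop (𝓝 0) := by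
    intro e
    induction e with
    | zero => exact hratio
    | succ e ih =>
      have := (hratio.comp (tendsto_add_atTop_nat (e + 1))).mul ih
      rw [mul_zero] at this
      refine this.congr fun k => ?_
      simp only [Function.comp]
      rw [div_mul_div_cancel₀ (hs _)]
      rfl
  induction L with
  | zero => simp
  | succ L ih =>
    -- The term k = L has the smallest index and dominates. Dividing by it forces `r L = 0`, and the
    -- shorter sum is left to the induction hypothesis.
    have hsub : Tendsto (fun N : ℕ => 2 * N + 1 - L) atTop atTop := by
      refine tendsto_atTop.2 fun b => ?_
      filter_upwards [eventually_ge_atTop (b + L)] with N hN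
      omega
    have h1 : Tendsto (fun N : ℕ => ∑ k ∈ Finset.range L, r k * (s (2 * N + 1 - k) / s (2 * N + 1 - L)))
        atTop (𝓝 (∑ k ∈ Finset.range L, r k * 0)) := by
      refine tendsto_finsetSum _ fun k hk => Tendsto.const_mul _ ?_
      have hk' := Finset.mem_range.1 hk
      refine ((hshift (L - k - 1)).comp hsub).congr' ?_
      filter_upwards [eventually_ge_atTop L] with N hN
      simp only [Function.comp]
      congr 2; omega
    simp only [mul_zero, Finset.sum_const_zero] at h1
    have h2 : ∀ᶠ N in atTop, ∑ k ∈ Finset.range L, r k * (s (2 * N + 1 - k) / s (2 * N + 1 - L))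
        = -r L := by
      filter_upwards [h] with N hN
      rw [Finset.sum_range_succ] at hN
      have h3 := hs (2 * N + 1 - L)
      simp only [← mul_div_assoc, ← Finset.sum_div]
      rw [div_eq_iff h3]
      linear_combination hN
    have h3 : r L = 0 := by
      have := tendsto_nhds_unique (tendsto_const_nhds.congr' (h2.mono fun N hN => hN.symm)) h1
      exact neg_eq_zero.1 this
    intro k hk
    rcases Nat.lt_succ_iff_lt_or_eq.1 hk with hk | rfl
    · refine ih ?_ k hk
      filter_upwards [h] with N hN
      rwa [Finset.sum_range_succ, h3, zero_mul, add_zero] at hN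
    · exact h3

/-- Interlacing of two sequences. -/
def interlace (a b : ℕ → ℂ) (k : ℕ) : ℂ := if k % 2 = 0 then a (k / 2) else b (k / 2)

theorem interlace_even (a b : ℕ → ℂ) (j : ℕ) : interlace a b (2 * j) = a j := by
  simp [interlace]

theorem interlace_odd (a b : ℕ → ℂ) (j : ℕ) : interlace a b (2 * j + 1) = b j := by
  rw [interlace, if_neg (by omega)]; congr 1; omega

theorem tendsto_interlace {a b : ℕ → ℂ} (h1 : Tendsto (fun j => b j / a j) atTop (𝓝 0))
    (h2 : Tendsto (fun j => a (j + 1) / b j) atTop (𝓝 0)) :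
    Tendsto (fun k => interlace a b (k + 1) / interlace a b k) atTop (𝓝 0) := by
  rw [Metric.tendsto_atTop] at *
  intro ε hε
  obtain ⟨N1, hN1⟩ := h1 ε hε
  obtain ⟨N2, hN2⟩ := h2 ε hε
  refine ⟨2 * (N1 + N2), fun k hk => ?_⟩
  rcases Nat.even_or_odd' k with ⟨j, rfl | rfl⟩
  · rw [interlace_odd, interlace_even]; exact hN1 j (by omega)
  · rw [show 2 * j + 1 + 1 = 2 * (j + 1) by ring, interlace_odd, interlace_even]
    exact hN2 j (by omega)

/-- The indices k and 2N + 1 - k have opposite parity, which pairs u with b and v with a. -/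
theorem sum_interlace (a b u v : ℕ → ℂ) (B N : ℕ) (hN : B ≤ N) :
    ∑ k ∈ Finset.range (2 * B), interlace u v k * interlace a b (2 * N + 1 - k) =
      ∑ i ∈ Finset.range B, (u i * b (N - i) + v i * a (N - i)) := by
  induction B with
  | zero => simp
  | succ B ih =>
    rw [show 2 * (B + 1) = 2 * B + 1 + 1 by ring, Finset.sum_range_succ, Finset.sum_range_succ,
      Finset.sum_range_succ, ih (by omega), interlace_even, interlace_odd,
      show 2 * N + 1 - 2 * B = 2 * (N - B) + 1 by omega,
      show 2 * N + 1 - (2 * B + 1) = 2 * (N - B) by omega, interlace_even, interlace_odd, add_assoc]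

theorem coeff_poly_mul (P : ℂ[X]) (F : PowerSeries ℂ) {B N : ℕ} (hP : P.natDegree < B) (hN : B ≤ N) :
    PowerSeries.coeff N ((P : PowerSeries ℂ) * F) =
      ∑ i ∈ Finset.range B, P.coeff i * PowerSeries.coeff (N - i) F := by
  rw [PowerSeries.coeff_mul, Finset.Nat.sum_antidiagonal_eq_sum_range_succ
    (fun i k => PowerSeries.coeff i (P : PowerSeries ℂ) * PowerSeries.coeff k F)]
  simp only [Polynomial.coeff_coe]
  symm
  refine Finset.sum_subset (Finset.range_mono (by omega)) fun i _ hi => ?_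
  rw [Polynomial.coeff_eq_zero_of_natDegree_lt, zero_mul]
  simp at hi; omega

/-- Interlaced as f₀, g₀, f₁, g₁, …, the coefficients form one sequence with ratios tending to 0.
For large N the N-th coefficient of PG + QF is a combination of boundedly many consecutive terms,
with coefficients independent of N. -/
theorem eq_zero_of_poly_mul_add {F G : PowerSeries ℂ}
    (hF : ∀ j, PowerSeries.coeff j F ≠ 0) (hG : ∀ j, PowerSeries.coeff j G ≠ 0)
    (h1 : Tendsto (fun j => PowerSeries.coeff j G / PowerSeries.coeff j F) atTop (𝓝 0))
    (h2 : Tendsto (fun j => PowerSeries.coeff (j + 1) F / PowerSeries.coeff j G) atTop (𝓝 0))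
    {P Q : ℂ[X]} (h : (P : PowerSeries ℂ) * G + (Q : PowerSeries ℂ) * F = 0) : P = 0 ∧ Q = 0 := by
  set a := fun j => PowerSeries.coeff j F
  set b := fun j => PowerSeries.coeff j G
  set B := P.natDegree + Q.natDegree + 1
  have key := eq_zero_of_ratio_tendsto (s := interlace a b)
    (r := interlace P.coeff Q.coeff) (L := 2 * B)
    (fun k => by unfold interlace; split_ifs; exacts [hF _, hG _]) (tendsto_interlace h1 h2) ?_
  · constructor
    · ext i
      by_cases hi : i < B
      · simpa [interlace_even] using key (2 * i) (by omega)
      · rw [Polynomial.coeff_eq_zero_of_natDegree_lt (by omega), Polynomial.coeff_zero]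
    · ext i
      by_cases hi : i < B
      · simpa [interlace_odd] using key (2 * i + 1) (by omega)
      · rw [Polynomial.coeff_eq_zero_of_natDegree_lt (by omega), Polynomial.coeff_zero]
  · filter_upwards [eventually_ge_atTop B] with N hN
    rw [sum_interlace _ _ _ _ _ _ hN, Finset.sum_add_distrib,
      ← coeff_poly_mul P G (by omega) hN, ← coeff_poly_mul Q F (by omega) hN, ← map_add, h, map_zero]

theorem hasSum_poly_mul {F : PowerSeries ℂ} {x s : ℂ}
    (h : HasSum (fun j => PowerSeries.coeff j F * x ^ j) s) (P : ℂ[X]) :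
    HasSum (fun j => PowerSeries.coeff j ((P : PowerSeries ℂ) * F) * x ^ j) (P.eval x * s) := by
  induction P using Polynomial.induction_on' with
  | add p q hp hq =>
    simpa [add_mul] using hp.add hq
  | monomial n a =>
    induction n generalizing a with
    | zero => simpa [mul_assoc] using h.mul_left a
    | succ n ih =>
      have h3 := (ih a).mul_left x
      have e : (Polynomial.monomial (n + 1) a : ℂ[X]) = Polynomial.X * Polynomial.monomial n a := by
        rw [Polynomial.X_mul_monomial]
      rw [e, Polynomial.coe_mul, Polynomial.coe_X, mul_assoc, Polynomial.eval_mul, Polynomial.eval_X,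
        ← hasSum_nat_add_iff' 1, Finset.sum_range_one, PowerSeries.coeff_zero_X_mul, zero_mul,
        sub_zero, mul_assoc]
      have e2 : (fun j => PowerSeries.coeff (j + 1) (PowerSeries.X *
          (((Polynomial.monomial n a : ℂ[X]) : PowerSeries ℂ) * F)) * x ^ (j + 1)) = fun j =>
          x * (PowerSeries.coeff j (((Polynomial.monomial n a : ℂ[X]) : PowerSeries ℂ) * F) * x ^ j) := by
        funext j
        rw [PowerSeries.coeff_succ_X_mul]
        ring
      rw [e2]
      exact h3

theorem eq_zero_of_hasSum_zero {F : PowerSeries ℂ}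
    (h : ∀ x : ℂ, HasSum (fun j => PowerSeries.coeff j F * x ^ j) 0) : F = 0 := by
  set p : FormalMultilinearSeries ℂ ℂ ℂ :=
    FormalMultilinearSeries.ofScalars ℂ fun j => PowerSeries.coeff j F
  have hp : HasFPowerSeriesAt (0 : ℂ → ℂ) p 0 := by
    rw [hasFPowerSeriesAt_iff]
    refine Eventually.of_forall fun x => ?_
    simpa [p, mul_comm] using h x
  have := hp.eq_zero
  ext j
  have h1 := congrArg (fun r : FormalMultilinearSeries ℂ ℂ ℂ => r.coeff j) this
  have h2 : (0 : FormalMultilinearSeries ℂ ℂ ℂ).coeff j = 0 := rfl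
  rw [h2] at h1
  simpa [p] using h1

theorem coeff_formalPhi_smul (c q y x : ℂ) (j : ℕ) :
    PowerSeries.coeff j (formalPhi c q (y * x)) = PowerSeries.coeff j (formalPhi c q y) * x ^ j := by
  rw [← rescale_formalPhi, PowerSeries.coeff_rescale, mul_comm]

theorem Generic.coeff_formalPhi_ne_zero {c q y : ℂ} (h : Generic c q) (hy : y ≠ 0) (j : ℕ) :
    PowerSeries.coeff j (formalPhi c q y) ≠ 0 := by
  rw [formalPhi, PowerSeries.coeff_mk]
  exact div_ne_zero (mul_ne_zero (pow_ne_zero _ h.q_ne) (pow_ne_zero _ hy))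
    (mul_ne_zero (h.qPoch_self_ne_zero j) (h.qPoch_ne_zero j))

/-- `₀φ₁(–; cq; q, xq)` and `₀φ₁(–; c; q, x)` are linearly independent over `ℂ[x]`. -/
theorem phi01_linearIndependent {c q : ℂ} (h : Generic c q) (hq : ‖q‖ < 1) {P Q : ℂ[X]}
    (hPQ : ∀ x : ℂ, P.eval x * phi01 (c * q) q (x * q) + Q.eval x * phi01 c q x = 0) :
    P = 0 ∧ Q = 0 := by
  have h' : Generic (c * q) q := by simpa using h.mul_zpow 1
  have hq0 := h.q_ne
  have hlim : Tendsto (fun j : ℕ => q ^ j) atTop (𝓝 0) := tendsto_pow_atTop_nhds_zero_of_norm_lt_one hq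
  refine eq_zero_of_poly_mul_add (F := formalPhi c q 1) (G := formalPhi (c * q) q q)
    (h.coeff_formalPhi_ne_zero one_ne_zero) (h'.coeff_formalPhi_ne_zero hq0) ?_ ?_ ?_
  -- The ratios are g_j/f_j = q^j(1-c)/(1-cq^j) and f_{j+1}/g_j = q^j/((1-q^{j+1})(1-c)), both
  -- tending to 0.
  · have h1 : Tendsto (fun j : ℕ => q ^ j * (1 - c) / (1 - c * q ^ j)) atTop
        (𝓝 (0 * (1 - c) / (1 - c * 0))) :=
      (hlim.mul_const _).div (tendsto_const_nhds.sub (hlim.const_mul c)) (by simp)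
    simp only [zero_mul, zero_div] at h1
    refine h1.congr fun j => ?_
    have n1 := h.qPoch_self_ne_zero j
    have n3 := h.one_sub_ne'
    have n4 := h'.qPoch_ne_zero j
    have n6 := h.one_sub_pow_ne' j
    have e : qPoch c q (j : ℤ) * (1 - c * q ^ j) = (1 - c) * qPoch (c * q) q (j : ℤ) := by
      rw [← qPoch_natCast_succ, qPoch_natCast_succ']
    have e' : qPoch c q (j : ℤ) = (1 - c) * qPoch (c * q) q (j : ℤ) / (1 - c * q ^ j) := by
      rw [eq_div_iff n6, e]
    simp only [formalPhi, PowerSeries.coeff_mk, one_pow]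
    rw [e']
    field_simp
  · have h1 : Tendsto (fun j : ℕ => q ^ j / ((1 - q * q ^ j) * (1 - c))) atTop
        (𝓝 (0 / ((1 - q * 0) * (1 - c)))) :=
      hlim.div ((tendsto_const_nhds.sub (hlim.const_mul q)).mul_const _) (by simpa using h.one_sub_ne')
    simp only [zero_div] at h1
    refine h1.congr fun j => ?_
    have n1 := h.qPoch_self_ne_zero j
    have n2 := h.one_sub_pow_ne j
    have n3 := h.one_sub_ne'
    have n4 := h'.qPoch_ne_zero j
    simp only [formalPhi, PowerSeries.coeff_mk, one_pow]
    rw [qPoch_natCast_succ, qPoch_natCast_succ', pow_mul_pred_succ, ← pow_succ']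
    field_simp
    ring
  · refine eq_zero_of_hasSum_zero fun x => ?_
    have s1 := h.hasSum hq x
    have s2 := h'.hasSum hq (q * x)
    rw [← one_mul x] at s1
    simp only [coeff_formalPhi_smul] at s1 s2
    rw [one_mul] at s1
    have := (hasSum_poly_mul s2 P).add (hasSum_poly_mul s1 Q)
    rw [mul_comm q x, hPQ x] at this
    simpa [add_mul] using this

end Independence

/-! ### Points in general position, and the passage between values and rational functions. -/

section GenericPoints

open Filter Topology

/-- On the line from a given point to one where D ≠ 0, the polynomial D restricts to a nonzero
polynomial in one variable, which has finitely many roots. -/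
theorem dense_eval_ne_zero {σ : Type*} [Finite σ] {D : MvPolynomial σ ℂ} (hD : D ≠ 0) :
    Dense {p : σ → ℂ | MvPolynomial.eval p D ≠ 0} := by
  intro p₀
  obtain ⟨p₁, hp₁⟩ : ∃ p₁, MvPolynomial.eval p₁ D ≠ 0 := by
    by_contra! h
    exact hD (MvPolynomial.funext fun p => by simpa using h p)
  set r : ℂ[X] := MvPolynomial.aeval
    (fun i => Polynomial.C (p₀ i) + Polynomial.X * Polynomial.C (p₁ i - p₀ i)) D
  have hr : ∀ t : ℂ, r.eval t = MvPolynomial.eval (fun i => p₀ i + t * (p₁ i - p₀ i)) D := by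
    intro t
    have : (Polynomial.aeval t).comp (MvPolynomial.aeval
      (fun i => Polynomial.C (p₀ i) + Polynomial.X * Polynomial.C (p₁ i - p₀ i))) =
      MvPolynomial.aeval (R := ℂ) (fun i => p₀ i + t * (p₁ i - p₀ i)) := by
      ext i; simp
    have h2 := DFunLike.congr_fun this D
    simpa [r, Polynomial.coe_aeval_eq_eval, MvPolynomial.aeval_eq_eval] using h2
  have hr0 : r ≠ 0 := by
    intro h0
    have := hr 1
    rw [h0, Polynomial.eval_zero] at this
    apply hp₁
    rw [this]; congr 2; funext i; ring
  have hd : Dense {t : ℂ | r.eval t ≠ 0} := by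
    have : {t : ℂ | r.eval t ≠ 0} = (r.roots.toFinset : Set ℂ)ᶜ := by
      ext t; simp [hr0]
    rw [this]
    exact (Finset.countable_toSet _).dense_compl ℂ
  have hcont : Continuous fun t : ℂ => fun i => p₀ i + t * (p₁ i - p₀ i) := by fun_prop
  have := map_mem_closure hcont (hd 0) (t := {p | MvPolynomial.eval p D ≠ 0})
    (fun t ht => by simpa [hr] using ht)
  simpa using this

/-- Points `(c, x, q)` in general position. -/
structure GenericPt (p : Fin 3 → ℂ) : Prop where
  generic : Generic (p 0) (p 2)
  norm_lt : ‖p 2‖ < 1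
  x_ne : p 1 ≠ 0
  ne : ∀ k l : ℤ, p 0 * p 2 ^ k - p 1 * p 2 ^ l ≠ 0

theorem generic_of_nat {c q : ℂ} (hq0 : q ≠ 0) (hq : ‖q‖ < 1) (hc0 : c ≠ 0)
    (h1 : ∀ k : ℕ, c * q ^ k ≠ 1) (h2 : ∀ k : ℕ, c ≠ q ^ k) : Generic c q where
  q_ne := hq0
  q_zpow k hk h := by
    have h3 := congrArg norm h
    rw [norm_zpow, norm_one] at h3
    exact hk ((zpow_eq_one_iff_right₀ (norm_nonneg _) hq.ne).1 h3)
  c_ne := hc0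
  c_zpow k := by
    obtain ⟨j, rfl | rfl⟩ := k.eq_nat_or_neg
    · simpa using h1 j
    · rw [zpow_neg, zpow_natCast]
      intro h
      exact h2 j (by rwa [mul_inv_eq_one₀ (pow_ne_zero _ hq0)] at h)

/-- Apart from |q| < 1, which is open, genericity follows from countably many polynomial inequations
once negative powers of q are cleared. Each defines a dense open set, and Baire's theorem applies.
-/
theorem frequently_genericPt {D : MvPolynomial (Fin 3) ℂ} (hD : D ≠ 0) {p₀ : Fin 3 → ℂ}
    (hp₀ : ‖p₀ 2‖ < 1) : ∃ᶠ p in 𝓝 p₀, GenericPt p ∧ MvPolynomial.eval p D ≠ 0 := by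
  set E : ℕ → MvPolynomial (Fin 3) ℂ := fun k =>
    D * (MvPolynomial.X 0 * MvPolynomial.X 1 * MvPolynomial.X 2) *
      (MvPolynomial.X 0 * MvPolynomial.X 2 ^ k - 1) * (MvPolynomial.X 0 - MvPolynomial.X 2 ^ k) *
      (MvPolynomial.X 0 * MvPolynomial.X 2 ^ k - MvPolynomial.X 1) *
      (MvPolynomial.X 0 - MvPolynomial.X 1 * MvPolynomial.X 2 ^ k) with hE
  have hE0 : ∀ k, E k ≠ 0 := by
    intro k
    have ne : ∀ (F : MvPolynomial (Fin 3) ℂ) (p : Fin 3 → ℂ), MvPolynomial.eval p F ≠ 0 → F ≠ 0 := by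
      rintro F p h rfl; simp at h
    refine mul_ne_zero (mul_ne_zero (mul_ne_zero (mul_ne_zero (mul_ne_zero hD ?_) ?_) ?_) ?_) ?_
    · exact mul_ne_zero (mul_ne_zero (MvPolynomial.X_ne_zero _) (MvPolynomial.X_ne_zero _))
        (MvPolynomial.X_ne_zero _)
    · exact ne _ ![0, 0, 0] (by simp)
    · refine ne _ ![2, 0, 1] ?_
      have h2 : (![2, 0, 1] : Fin 3 → ℂ) 2 = 1 := rfl
      rw [map_sub, map_pow, MvPolynomial.eval_X, MvPolynomial.eval_X, h2, one_pow]
      norm_num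
    · exact ne _ ![0, 1, 0] (by simp)
    · exact ne _ ![1, 0, 0] (by simp)
  have hdense : Dense (⋂ k, {p : Fin 3 → ℂ | MvPolynomial.eval p (E k) ≠ 0}) := by
    refine dense_iInter_of_isOpen (fun k => ?_) fun k => dense_eval_ne_zero (hE0 k)
    exact isOpen_ne_fun (MvPolynomial.continuous_eval _) continuous_const
  have h1 := mem_closure_iff_frequently.1 (hdense p₀)
  have h2 : ∀ᶠ p : Fin 3 → ℂ in 𝓝 p₀, ‖p 2‖ < 1 := by
    have : Continuous fun p : Fin 3 → ℂ => ‖p 2‖ := by fun_prop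
    exact (this.tendsto p₀).eventually_lt_const hp₀
  refine (h1.and_eventually h2).mono fun p hp => ?_
  obtain ⟨hp, hq⟩ := hp
  simp only [Set.mem_iInter, Set.mem_ofPred_eq, hE, map_mul, map_sub, map_pow, map_one,
    MvPolynomial.eval_X, mul_ne_zero_iff] at hp
  have h0 := hp 0
  have hq0 : p 2 ≠ 0 := h0.1.1.1.1.2.2
  refine ⟨⟨generic_of_nat hq0 hq h0.1.1.1.1.2.1.1 (fun k => ?_) (fun k => ?_), hq,
    h0.1.1.1.1.2.1.2, fun k l => ?_⟩, h0.1.1.1.1.1⟩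
  · exact sub_ne_zero.1 (hp k).1.1.1.2
  · exact sub_ne_zero.1 (hp k).1.1.2
  · have e : p 0 * p 2 ^ k - p 1 * p 2 ^ l = p 2 ^ l * (p 0 * p 2 ^ (k - l) - p 1) := by
      rw [zpow_sub₀ hq0]
      have := zpow_ne_zero l hq0
      field_simp
    rw [e]
    refine mul_ne_zero (zpow_ne_zero _ hq0) ?_
    obtain ⟨j, hj | hj⟩ := (k - l).eq_nat_or_neg
    · rw [hj, zpow_natCast]; exact (hp j).1.2
    · rw [hj, zpow_neg, zpow_natCast]
      intro h
      apply (hp j).2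
      have := pow_ne_zero j hq0
      field_simp at h
      linear_combination h

theorem exists_genericPt {D : MvPolynomial (Fin 3) ℂ} (hD : D ≠ 0) :
    ∃ p, GenericPt p ∧ MvPolynomial.eval p D ≠ 0 :=
  (frequently_genericPt hD (p₀ := 0) (by simp)).exists

/-- Polynomials as rational functions. -/
noncomputable abbrev toRat : MvPolynomial (Fin 3) ℂ →+* RatCXQ :=
  algebraMap (MvPolynomial (Fin 3) ℂ) RatCXQ

theorem toRat_injective : Function.Injective toRat := IsFractionRing.injective _ _

theorem toRat_ne_zero {D : MvPolynomial (Fin 3) ℂ} (hD : D ≠ 0) : toRat D ≠ 0 := by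
  rwa [Ne, map_eq_zero_iff _ toRat_injective]

/-- The rational function `r` takes the values `φ` at the points in general position, up to a
polynomial factor. -/
def GenVal (r : RatCXQ) (φ : (Fin 3 → ℂ) → ℂ) : Prop :=
  ∃ N D : MvPolynomial (Fin 3) ℂ, D ≠ 0 ∧ toRat D * r = toRat N ∧
    ∀ p, GenericPt p → MvPolynomial.eval p D * φ p = MvPolynomial.eval p N

namespace GenVal
variable {r s : RatCXQ} {φ ψ : (Fin 3 → ℂ) → ℂ}

theorem poly (N : MvPolynomial (Fin 3) ℂ) : GenVal (toRat N) fun p => MvPolynomial.eval p N :=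
  ⟨N, 1, one_ne_zero, by rw [map_one, one_mul], fun p _ => by rw [map_one, one_mul]⟩

theorem one : GenVal 1 fun _ => 1 := by simpa using poly 1

theorem sub (h : GenVal r φ) (h' : GenVal s ψ) : GenVal (r - s) fun p => φ p - ψ p := by
  obtain ⟨N, D, hD, h1, h2⟩ := h
  obtain ⟨N', D', hD', h1', h2'⟩ := h'
  refine ⟨N * D' - N' * D, D * D', mul_ne_zero hD hD', ?_, fun p hp => ?_⟩
  · simp only [map_mul, map_sub]
    linear_combination toRat D' * h1 - toRat D * h1'
  · simp only [map_mul, map_sub]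
    linear_combination MvPolynomial.eval p D' * h2 p hp - MvPolynomial.eval p D * h2' p hp

theorem mul (h : GenVal r φ) (h' : GenVal s ψ) : GenVal (r * s) fun p => φ p * ψ p := by
  obtain ⟨N, D, hD, h1, h2⟩ := h
  obtain ⟨N', D', hD', h1', h2'⟩ := h'
  refine ⟨N * N', D * D', mul_ne_zero hD hD', ?_, fun p hp => ?_⟩
  · simp only [map_mul, ← h1, ← h1']; ring
  · simp only [map_mul, ← h2 p hp, ← h2' p hp]; ring

theorem exists_eq_zero (h : GenVal 0 φ) : ∃ p, GenericPt p ∧ φ p = 0 := by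
  obtain ⟨N, D, hD, h1, h2⟩ := h
  rw [mul_zero] at h1
  have hN : N = 0 := toRat_injective (by rw [← h1, map_zero])
  obtain ⟨p, hp, hDp⟩ := exists_genericPt hD
  have := h2 p hp
  rw [hN, map_zero] at this
  exact ⟨p, hp, (mul_eq_zero.1 this).resolve_left hDp⟩

theorem ne_zero (h : GenVal r φ) (hφ : ∀ p, GenericPt p → φ p ≠ 0) : r ≠ 0 := by
  rintro rfl
  obtain ⟨p, hp, h0⟩ := h.exists_eq_zero
  exact hφ p hp h0

theorem inv (h : GenVal r φ) (hφ : ∀ p, GenericPt p → φ p ≠ 0) : GenVal r⁻¹ fun p => (φ p)⁻¹ := by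
  have hr := h.ne_zero hφ
  obtain ⟨N, D, hD, h1, h2⟩ := h
  have hN : N ≠ 0 := by
    rintro rfl
    rw [map_zero] at h1
    exact mul_ne_zero (toRat_ne_zero hD) hr h1
  refine ⟨D, N, hN, ?_, fun p hp => ?_⟩
  · rw [← h1, mul_inv_cancel_right₀ hr]
  · rw [← h2 p hp, mul_inv_cancel_right₀ (hφ p hp)]

theorem zpow (h : GenVal r φ) (hφ : ∀ p, GenericPt p → φ p ≠ 0) (k : ℤ) :
    GenVal (r ^ k) fun p => φ p ^ k := by
  have hpow : ∀ j : ℕ, GenVal (r ^ j) fun p => φ p ^ j := by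
    intro j
    induction j with
    | zero => simpa using one
    | succ j ih => simp only [pow_succ]; exact ih.mul h
  obtain ⟨j, rfl | rfl⟩ := k.eq_nat_or_neg
  · simpa using hpow j
  · simpa using (hpow j).inv fun p hp => pow_ne_zero _ (hφ p hp)

theorem varC : GenVal varC fun p => p 0 := by
  simpa [ZeroPhiOne.varC] using poly (MvPolynomial.X 0)
theorem varX : GenVal varX fun p => p 1 := by
  simpa [ZeroPhiOne.varX] using poly (MvPolynomial.X 1)
theorem varQ : GenVal varQ fun p => p 2 := by
  simpa [ZeroPhiOne.varQ] using poly (MvPolynomial.X 2)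

theorem varQ_zpow (k : ℤ) : GenVal (ZeroPhiOne.varQ ^ k) fun p => p 2 ^ k :=
  varQ.zpow (fun _ hp => hp.generic.q_ne) k

theorem one_sub (k : ℤ) : GenVal (1 - ZeroPhiOne.varC * ZeroPhiOne.varQ ^ k) fun p => 1 - p 0 * p 2 ^ k :=
  one.sub (varC.mul (varQ_zpow k))

end GenVal

/-- This admits ℂ(c,x,q), with the variables as parameters, as an instance of the algebra over `K`.
-/
theorem generic_var : Generic varC varQ where
  q_ne := GenVal.varQ.ne_zero fun _ hp => hp.generic.q_ne
  q_zpow k hk := sub_ne_zero.1 <| ((GenVal.varQ_zpow k).sub GenVal.one).ne_zero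
    fun _ hp => sub_ne_zero.2 (hp.generic.q_zpow k hk)
  c_ne := GenVal.varC.ne_zero fun _ hp => hp.generic.c_ne
  c_zpow k := (sub_ne_zero.1 <| (GenVal.one_sub k).ne_zero fun _ hp => hp.generic.one_sub_ne k).symm

theorem varX_ne_zero : varX ≠ 0 := GenVal.varX.ne_zero fun _ hp => hp.x_ne

theorem varC_mul_sub_ne_zero (k l : ℤ) : varC * varQ ^ k - varX * varQ ^ l ≠ 0 :=
  ((GenVal.varC.mul (GenVal.varQ_zpow k)).sub (GenVal.varX.mul (GenVal.varQ_zpow l))).ne_zero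
    fun _ hp => hp.ne k l

/-- `₀φ₁(–; cq^m; q, xq^n)` at the point `p = (c, x, q)`. -/
noncomputable def phiAt (m n : ℤ) (p : Fin 3 → ℂ) : ℂ := phi01 (p 0 * p 2 ^ m) (p 2) (p 1 * p 2 ^ n)

theorem GenericPt.isContig {p : Fin 3 → ℂ} (hp : GenericPt p) :
    IsContig (p 0) (p 2) (p 1) fun m n => phiAt m n p :=
  isContig_phi01 hp.generic hp.norm_lt (p 1)

/-- `g = U ₀φ₁(–; cq; q, xq) + V ₀φ₁(–; c; q, x)` at the points in general position, up to a
polynomial factor. -/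
def GenRel (U V : RatCXQ) (g : (Fin 3 → ℂ) → ℂ) : Prop :=
  ∃ N M D : MvPolynomial (Fin 3) ℂ, D ≠ 0 ∧ toRat D * U = toRat N ∧ toRat D * V = toRat M ∧
    ∀ p, GenericPt p → MvPolynomial.eval p D * g p =
      MvPolynomial.eval p N * phiAt 1 1 p + MvPolynomial.eval p M * phiAt 0 0 p

namespace GenRel
variable {U V U' V' r : RatCXQ} {g g' φ : (Fin 3 → ℂ) → ℂ}

theorem sub (h : GenRel U V g) (h' : GenRel U' V' g') :
    GenRel (U - U') (V - V') fun p => g p - g' p := by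
  obtain ⟨N, M, D, hD, h1, h2, h3⟩ := h
  obtain ⟨N', M', D', hD', h1', h2', h3'⟩ := h'
  refine ⟨N * D' - N' * D, M * D' - M' * D, D * D', mul_ne_zero hD hD', ?_, ?_, fun p hp => ?_⟩
  · simp only [map_mul, map_sub]
    linear_combination toRat D' * h1 - toRat D * h1'
  · simp only [map_mul, map_sub]
    linear_combination toRat D' * h2 - toRat D * h2'
  · simp only [map_mul, map_sub]
    linear_combination MvPolynomial.eval p D' * h3 p hp - MvPolynomial.eval p D * h3' p hp

theorem smul (hr : GenVal r φ) (h : GenRel U V g) :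
    GenRel (r * U) (r * V) fun p => φ p * g p := by
  obtain ⟨N, M, D, hD, h1, h2, h3⟩ := h
  obtain ⟨N', D', hD', h1', h2'⟩ := hr
  refine ⟨N' * N, N' * M, D' * D, mul_ne_zero hD' hD, ?_, ?_, fun p hp => ?_⟩
  · simp only [map_mul, ← h1, ← h1']; ring
  · simp only [map_mul, ← h2, ← h1']; ring
  · simp only [map_mul, ← h2' p hp]
    linear_combination MvPolynomial.eval p D' * φ p * h3 p hp

theorem congr (h : GenRel U V g) (hg : ∀ p, GenericPt p → g p = g' p) : GenRel U V g' := by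
  obtain ⟨N, M, D, hD, h1, h2, h3⟩ := h
  exact ⟨N, M, D, hD, h1, h2, fun p hp => hg p hp ▸ h3 p hp⟩

theorem base_one : GenRel 1 0 (phiAt 1 1) :=
  ⟨1, 0, 1, one_ne_zero, by simp, by simp, fun p _ => by simp⟩

theorem base_zero : GenRel 0 1 (phiAt 0 0) :=
  ⟨0, 1, 1, one_ne_zero, by simp, by simp, fun p _ => by simp⟩

/-- For fixed generic c and q the relation holds for all x outside a countable set, hence for all x
by continuity. Linear independence then kills both polynomials in x, and polynomials vanishing at
all generic points are zero. -/
theorem eq_zero_of_combination {N M : MvPolynomial (Fin 3) ℂ}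
    (h : ∀ p, GenericPt p → MvPolynomial.eval p N * phiAt 1 1 p +
      MvPolynomial.eval p M * phiAt 0 0 p = 0) : N = 0 ∧ M = 0 := by
  set line : (Fin 3 → ℂ) → MvPolynomial (Fin 3) ℂ →+* ℂ[X] := fun p =>
    (MvPolynomial.aeval ![Polynomial.C (p 0), Polynomial.X, Polynomial.C (p 2)] :
      MvPolynomial (Fin 3) ℂ →ₐ[ℂ] ℂ[X]).toRingHom
  have hline : ∀ p F x, (line p F).eval x = MvPolynomial.eval ![p 0, x, p 2] F := by
    intro p F x
    have : (Polynomial.aeval x).comp (MvPolynomial.aeval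
        ![Polynomial.C (p 0), Polynomial.X, Polynomial.C (p 2)]) =
        MvPolynomial.aeval (R := ℂ) ![p 0, x, p 2] := by
      ext i; fin_cases i <;> simp
    have h2 := DFunLike.congr_fun this F
    simpa [line, Polynomial.coe_aeval_eq_eval, MvPolynomial.aeval_eq_eval] using h2
  have key : ∀ p, GenericPt p → line p N = 0 ∧ line p M = 0 := by
    intro p hp
    refine phi01_linearIndependent hp.generic hp.norm_lt fun x => ?_
    set c := p 0
    set q := p 2
    have hcont : ∀ (b : ℂ) (r : ℂ), Generic b q → Continuous fun x => phi01 b q (x * r) := by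
      intro b r hb
      rw [continuous_iff_continuousAt]
      intro x
      have h1 := continuousAt_phi01 (x * r) hp.norm_lt hb.one_sub_pow_ne'
      exact ContinuousAt.comp (f := fun x : ℂ => (b, q, x * r)) h1
        (Continuous.continuousAt (by fun_prop))
    have c1 := hcont (c * q) q (by simpa using hp.generic.mul_zpow 1)
    have c2 := hcont c 1 hp.generic
    simp only [mul_one] at c2
    have hbad : ({0} ∪ ⋃ kl : ℤ × ℤ, {c * q ^ kl.1 / q ^ kl.2} : Set ℂ).Countable :=
      (Set.countable_singleton _).union (Set.countable_iUnion fun _ => Set.countable_singleton _)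
    have hd := hbad.dense_compl ℂ
    have := Continuous.ext_on hd
      (f := fun x => (line p N).eval x * phi01 (c * q) q (x * q) + (line p M).eval x * phi01 c q x)
      (g := fun _ => 0)
      (((line p N).continuous.mul c1).add ((line p M).continuous.mul c2)) continuous_const ?_
    · exact congrFun this x
    · intro x hx
      simp only [Set.mem_compl_iff, Set.mem_union, Set.mem_singleton_iff, Set.mem_iUnion,
        not_or, not_exists] at hx
      have hp' : GenericPt ![c, x, q] := by
        refine ⟨hp.generic, hp.norm_lt, hx.1, fun k l h0 => hx.2 (k, l) ?_⟩
        rw [eq_div_iff (zpow_ne_zero _ hp.generic.q_ne)]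
        exact (sub_eq_zero.1 h0).symm
      have := h _ hp'
      simpa [phiAt, hline] using this
  have fin : ∀ F, (∀ p, GenericPt p → line p F = 0) → F = 0 := by
    intro F hF
    by_contra h0
    obtain ⟨p, hp, hFp⟩ := exists_genericPt h0
    apply hFp
    have := hline p F (p 1)
    rw [hF p hp, Polynomial.eval_zero] at this
    rw [this]
    congr 2
    funext i; fin_cases i <;> rfl
  exact ⟨fin N fun p hp => (key p hp).1, fin M fun p hp => (key p hp).2⟩

theorem unique (h : GenRel U V g) (h' : GenRel U' V' g) : U = U' ∧ V = V' := by
  obtain ⟨N, M, D, hD, h1, h2, h3⟩ := h.sub h'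
  obtain ⟨rfl, rfl⟩ := eq_zero_of_combination (N := N) (M := M) fun p hp => by
    rw [← h3 p hp]; simp
  rw [map_zero, mul_eq_zero, or_iff_right (toRat_ne_zero hD), sub_eq_zero] at h1 h2
  exact ⟨h1, h2⟩

end GenRel

end GenericPoints

/-! ### Equivalence with the stated recurrence, existence, and relations for U and V. -/

section Recurrence

open Filter Topology

theorem Generic.lowerOK {c q : ℂ} (h : Generic c q) : LowerOK c q := by
  intro i hi
  apply h.c_zpow i
  rw [hi, ← zpow_add₀ h.q_ne]; simp

theorem GenRel.of_isRecurrence {m n : ℤ} {U V : RatCXQ} (h : IsRecurrence m n U V) :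
    GenRel U V (phiAt m n) := by
  obtain ⟨N₁, D₁, hD₁, rfl⟩ := IsFractionRing.div_surjective (A := MvPolynomial (Fin 3) ℂ) U
  obtain ⟨N₂, D₂, hD₂, rfl⟩ := IsFractionRing.div_surjective (A := MvPolynomial (Fin 3) ℂ) V
  have hD₁' := nonZeroDivisors.ne_zero hD₁
  have hD₂' := nonZeroDivisors.ne_zero hD₂
  have n1 := toRat_ne_zero hD₁'
  have n2 := toRat_ne_zero hD₂'
  -- The extra factor D₁D₂ reduces the identity to 0 = 0 at generic points where U or V has a
  -- vanishing denominator.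
  refine ⟨N₁ * D₂ * (D₁ * D₂), N₂ * D₁ * (D₁ * D₂), D₁ * D₂ * (D₁ * D₂),
    mul_ne_zero (mul_ne_zero hD₁' hD₂') (mul_ne_zero hD₁' hD₂'), ?_, ?_, fun p hp => ?_⟩
  · simp only [map_mul]; field_simp
  · simp only [map_mul]; field_simp
  · simp only [map_mul]
    by_cases h1 : MvPolynomial.eval p D₁ = 0
    · simp [h1]
    by_cases h2 : MvPolynomial.eval p D₂ = 0
    · simp [h2]
    have hg := hp.generic
    have hpe : ![p 0, p 1, p 2] = p := by
      funext i; fin_cases i <;> rfl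
    have := h (p 0) (p 1) (p 2) (norm_pos_iff.2 hg.q_ne) hp.norm_lt hg.lowerOK
      (by simpa using (hg.mul_zpow 1).lowerOK) (hg.mul_zpow m).lowerOK _ _
      ⟨N₁, D₁, by rwa [hpe], rfl, rfl⟩ ⟨N₂, D₂, by rwa [hpe], rfl, rfl⟩
    rw [hpe] at this
    simp only [phiAt, zpow_one, zpow_zero, mul_one, this]
    field_simp

theorem tendsto_phiAt {p : Fin 3 → ℂ} (hq0 : p 2 ≠ 0) (hq : ‖p 2‖ < 1) (m n : ℤ)
    (h : LowerOK (p 0 * p 2 ^ m) (p 2)) : Tendsto (phiAt m n) (𝓝 p) (𝓝 (phiAt m n p)) := by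
  have h1 := continuousAt_phi01 (p 1 * p 2 ^ n) hq h.one_sub_ne
  have h2 : ContinuousAt (fun p : Fin 3 → ℂ => (p 0 * p 2 ^ m, p 2, p 1 * p 2 ^ n)) p := by
    have hz : ∀ k : ℤ, ContinuousAt (fun p : Fin 3 → ℂ => p 2 ^ k) p := fun k =>
      (continuous_apply 2).continuousAt.zpow₀ k (Or.inl hq0)
    exact ((continuous_apply 0).continuousAt.mul (hz m)).prodMk
      ((continuous_apply 2).continuousAt.prodMk ((continuous_apply 1).continuousAt.mul (hz n)))
  exact ContinuousAt.comp (f := fun p : Fin 3 → ℂ => (p 0 * p 2 ^ m, p 2, p 1 * p 2 ^ n)) h1 h2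

/-- Generic points accumulate at every admissible point, and both sides are continuous there. The
common denominator D may vanish at the point itself, so the limit is taken along generic points
where D and the local denominators are nonzero. -/
theorem GenRel.isRecurrence {m n : ℤ} {U V : RatCXQ} (h : GenRel U V (phiAt m n)) :
    IsRecurrence m n U V := by
  rintro c x q hq0 hq hc hcq hcm u v ⟨N₁, D₁, hD₁, hU, rfl⟩ ⟨N₂, D₂, hD₂, hV, rfl⟩
  obtain ⟨N, M, D, hD, h1, h2, h3⟩ := h
  set p : Fin 3 → ℂ := ![c, x, q] with hp
  have ne : ∀ F : MvPolynomial (Fin 3) ℂ, MvPolynomial.eval p F ≠ 0 → F ≠ 0 := by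
    rintro F hF rfl; simp at hF
  have hq0' : p 2 ≠ 0 := norm_pos_iff.1 hq0
  have n1 := toRat_ne_zero (ne _ hD₁)
  have n2 := toRat_ne_zero (ne _ hD₂)
  have e1 : D * N₁ = N * D₁ := by
    apply toRat_injective
    rw [map_mul, map_mul, ← h1, hU]
    field_simp
  have e2 : D * N₂ = M * D₂ := by
    apply toRat_injective
    rw [map_mul, map_mul, ← h2, hV]
    field_simp
  have t := tendsto_phiAt (p := p) hq0' hq m n hcm
  have t1 := tendsto_phiAt (p := p) hq0' hq 1 1 (by simpa [hp] using hcq)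
  have t0 := tendsto_phiAt (p := p) hq0' hq 0 0 (by simpa [hp] using hc)
  have tp : ∀ F : MvPolynomial (Fin 3) ℂ, Tendsto (fun p => MvPolynomial.eval p F) (𝓝 p)
      (𝓝 (MvPolynomial.eval p F)) := fun F => (MvPolynomial.continuous_eval F).tendsto p
  have tr := (((tp N₁).div (tp D₁) hD₁).mul t1).add (((tp N₂).div (tp D₂) hD₂).mul t0)
  have hfreq := frequently_genericPt (mul_ne_zero hD (mul_ne_zero (ne _ hD₁) (ne _ hD₂)))
    (p₀ := p) hq
  have := tendsto_nhds_unique_of_frequently_eq t tr (hfreq.mono fun r hr => ?_)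
  · simpa [phiAt, hp] using this
  · obtain ⟨hr, hne⟩ := hr
    simp only [map_mul, mul_ne_zero_iff] at hne
    obtain ⟨k0, k1, k2⟩ := hne
    have e3 := h3 r hr
    have e1' := congrArg (MvPolynomial.eval r) e1
    have e2' := congrArg (MvPolynomial.eval r) e2
    simp only [map_mul] at e1' e2'
    apply mul_left_cancel₀ k0
    simp only [Pi.div_apply]
    rw [e3, mul_add, ← mul_assoc, ← mul_assoc, ← mul_div_assoc, ← mul_div_assoc, e1', e2',
      mul_div_cancel_right₀ _ k1, mul_div_cancel_right₀ _ k2]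

theorem genRel_iff {m n : ℤ} {U V : RatCXQ} : GenRel U V (phiAt m n) ↔ IsRecurrence m n U V :=
  ⟨GenRel.isRecurrence, GenRel.of_isRecurrence⟩

theorem exists_genRel (m n : ℤ) : ∃ U V, GenRel U V (phiAt m n) := by
  have hne : ∀ (k : ℤ) p, GenericPt p → 1 - p 0 * p 2 ^ k ≠ 0 :=
    fun k p hp => hp.generic.one_sub_ne k
  have hqne : ∀ (k : ℤ) p, GenericPt p → p 2 ^ k ≠ 0 :=
    fun k p hp => zpow_ne_zero _ hp.generic.q_ne
  have comb : ∀ {g g₁ g₂ a b : (Fin 3 → ℂ) → ℂ} {r s : RatCXQ}, (∃ U V, GenRel U V g₁) →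
      (∃ U V, GenRel U V g₂) → GenVal r a → GenVal s b →
      (∀ p, GenericPt p → a p * g₁ p - b p * g₂ p = g p) → ∃ U V, GenRel U V g := by
    rintro g g₁ g₂ a b r s ⟨U, V, h⟩ ⟨U', V', h'⟩ ha hb hg
    exact ⟨_, _, ((h.smul ha).sub (h'.smul hb)).congr hg⟩
  have vq := GenVal.varQ_zpow
  have v1 := GenVal.one_sub
  have vx := GenVal.varX
  have vc := GenVal.varC
  have b1 : ∃ U V, GenRel U V (phiAt 1 1) := ⟨_, _, GenRel.base_one⟩
  have b0 : ∃ U V, GenRel U V (phiAt 0 0) := ⟨_, _, GenRel.base_zero⟩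
  have vneg : GenVal (0 - 1) fun _ => 0 - 1 := by
    simpa using (GenVal.one.sub GenVal.one).sub GenVal.one
  have vdown : ∀ n : ℤ, GenVal _ fun p : Fin 3 → ℂ => (p 0 * p 2 ^ (1 - 1 : ℤ) - p 1 * p 2 ^ n) :=
    fun n => (vc.mul (vq _)).sub (vx.mul (vq n))
  refine IsContig.lattice_induction (Q := fun m n => ∃ U V, GenRel U V (phiAt m n))
    b0 ?_ b1 ?_ ?_ ?_ ?_ ?_ ?_ m n
  · refine comb b0 b1 (v1 0) (vneg.mul (vc.mul (vq 0))) fun p hp => ?_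
    have e := hp.isContig.eq_sub 0 0
    rw [zero_add] at e
    linear_combination e
  · intro n _ h1 h2
    have hinv := (vdown n).inv fun p hp => hp.ne _ n
    refine comb h2 h1 (((GenVal.one.sub (vneg.mul (vc.mul (vq (1 - 1))))).mul hinv)) hinv
      fun p hp => ?_
    have e := hp.isContig.three_term 1 n
    have h0 := hp.ne (1 - 1) n
    apply mul_left_cancel₀ h0
    rw [e]
    field_simp
    ring
  · intro n _ h1 h2
    refine comb h1 h2 (GenVal.one.sub (vneg.mul (vc.mul (vq (1 - 1))))) (vdown n) fun p hp => ?_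
    linear_combination -hp.isContig.three_term 1 n
  · intro n _ h1 h2
    refine comb h1 (h2 (n + 2)) GenVal.one ((vx.mul (vq n)).mul ((v1 0).inv (hne 0))) fun p hp => ?_
    have e := hp.isContig.sub_eq 0 n
    have h0 := hne 0 p hp
    rw [zero_add] at e
    apply mul_left_cancel₀ h0
    linear_combination (-(p 1 * p 2 ^ n * phiAt 1 (n + 2) p)) * mul_inv_cancel₀ h0 + e
  · intro n _ h1 h2
    refine comb h1 h2 GenVal.one (vneg.mul ((vx.mul (vq n)).mul ((v1 0).inv (hne 0)))) fun p hp => ?_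
    have e := hp.isContig.sub_eq 0 n
    have h0 := hne 0 p hp
    rw [zero_add] at e
    apply mul_left_cancel₀ h0
    linear_combination p 1 * p 2 ^ n * phiAt 1 (n + 2) p * mul_inv_cancel₀ h0 - e
  · intro m n _ h1 h2
    refine comb h1 h2 ((v1 m).inv (hne m)) ((vc.mul (vq m)).mul ((v1 m).inv (hne m))) fun p hp => ?_
    have e := hp.isContig.eq_sub m n
    have h0 := hne m p hp
    apply mul_left_cancel₀ h0
    rw [e]
    field_simp
  · intro m n _ h1 h2
    have hxq : ∀ p, GenericPt p → p 1 * p 2 ^ n ≠ 0 := fun p hp => mul_ne_zero hp.x_ne (hqne n p hp)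
    have hv := (v1 m).mul ((vx.mul (vq n)).inv hxq)
    refine comb h1 h2 hv hv fun p hp => ?_
    have e := hp.isContig.sub_eq m n
    have h0 := hxq p hp
    apply mul_left_cancel₀ h0
    rw [← e]
    have := hp.x_ne
    have := hqne n p hp
    field_simp

/-- Each contiguous relation of ₀φ₁ expresses one function in two ways through the basic pair;
uniqueness allows the coefficients to be compared. -/
theorem isContig_of_genRel {U V : ℤ → ℤ → RatCXQ} (h : ∀ m n, GenRel (U m n) (V m n) (phiAt m n)) :
    IsContig varC varQ varX U ∧ IsContig varC varQ varX V := by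
  have e1 : ∀ m n : ℤ, (1 - varC * varQ ^ m) * (U m n - U m (n + 1)) =
      varX * varQ ^ n * U (m + 1) (n + 2) ∧ (1 - varC * varQ ^ m) * (V m n - V m (n + 1)) =
      varX * varQ ^ n * V (m + 1) (n + 2) := fun m n =>
    (((h m n).sub (h m (n + 1))).smul (GenVal.one_sub m)).unique
      (((h (m + 1) (n + 2)).smul (GenVal.varX.mul (GenVal.varQ_zpow n))).congr fun p hp =>
        (hp.isContig.sub_eq m n).symm)
  have e2 : ∀ m n : ℤ, (1 - varC * varQ ^ m) * U m n =
      U (m + 1) n - varC * varQ ^ m * U (m + 1) (n + 1) ∧ (1 - varC * varQ ^ m) * V m n =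
      V (m + 1) n - varC * varQ ^ m * V (m + 1) (n + 1) := fun m n =>
    ((h m n).smul (GenVal.one_sub m)).unique
      (((h (m + 1) n).sub ((h (m + 1) (n + 1)).smul
        (GenVal.varC.mul (GenVal.varQ_zpow m)))).congr fun p hp => (hp.isContig.eq_sub m n).symm)
  exact ⟨⟨fun m n => (e1 m n).1, fun m n => (e2 m n).1⟩,
    ⟨fun m n => (e1 m n).2, fun m n => (e2 m n).2⟩⟩

theorem shift_toRat (F : MvPolynomial (Fin 3) ℂ) : shift (toRat F) = toRat (shiftPoly F) :=
  IsLocalization.map_eq (M := nonZeroDivisors (MvPolynomial (Fin 3) ℂ)) (S := RatCXQ)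
    (nonZeroDivisors_le_comap_nonZeroDivisors_of_injective shiftPoly.toRingHom shiftPoly_injective) F

theorem shift_varC : shift varC = varC * varQ := by
  rw [varC, shift_toRat]
  simp [shiftPoly, varQ]

theorem shift_varX : shift varX = varX * varQ := by
  rw [varX, shift_toRat]
  simp [shiftPoly, varQ]

theorem shift_varQ : shift varQ = varQ := by
  rw [varQ, shift_toRat]
  simp [shiftPoly]

/-- Since cq · q^{m-1} = cq^m and xq · q^{n-1} = xq^n, the substitution compensates the shift of the
lattice. -/
theorem isContig_shift {U : ℤ → ℤ → RatCXQ} (h : IsContig varC varQ varX U) (r : RatCXQ) :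
    IsContig varC varQ varX fun m n => r * shift (U (m - 1) (n - 1)) where
  sub_eq m n := by
    have hq := generic_var.q_ne
    have e := congrArg shift (h.sub_eq (m - 1) (n - 1))
    simp only [map_mul, map_sub, map_one, map_zpow₀, shift_varC, shift_varX, shift_varQ] at e
    rw [mul_assoc varC, ← zpow_one_add₀ hq, mul_assoc varX, ← zpow_one_add₀ hq,
      show 1 + (m - 1) = m by ring, show 1 + (n - 1) = n by ring] at e
    rw [show n + 1 - 1 = n - 1 + 1 by ring, show m + 1 - 1 = m - 1 + 1 by ring,
      show n + 2 - 1 = n - 1 + 2 by ring]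
    linear_combination r * e
  eq_sub m n := by
    have hq := generic_var.q_ne
    have e := congrArg shift (h.eq_sub (m - 1) (n - 1))
    simp only [map_mul, map_sub, map_one, map_zpow₀, shift_varC, shift_varQ] at e
    rw [mul_assoc varC, ← zpow_one_add₀ hq, show 1 + (m - 1) = m by ring] at e
    rw [show n + 1 - 1 = n - 1 + 1 by ring, show m + 1 - 1 = m - 1 + 1 by ring]
    linear_combination r * e

end Recurrence

end ZeroPhiOne

/-! ### The theorem, by comparison of values at (0,0) and (1,1). -/

open ZeroPhiOne

theorem theorem3 :
    (∀ m n : ℤ, ∃! UV : RatCXQ × RatCXQ, IsRecurrence m n UV.1 UV.2) ∧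
    ∀ U V : ℤ → ℤ → RatCXQ, (∀ m n : ℤ, IsRecurrence m n (U m n) (V m n)) →
      ∀ m n : ℤ,
        V m n = (1 - varC) * (1 - varC * varQ) / varX * shift (U (m - 1) (n - 1)) ∧
        U m n = -(1 / ((varQ - varC) * (1 - varC)))
          * (varX ^ (1 - max m 0) / qPoch (varX / varC) varQ (max (n - m) 0))
          * (P01 m n varC varQ).eval varX ∧
        (∀ i : ℕ, (P01 m n varC varQ).coeff i ∈
          IntermediateField.adjoin ℂ ({varC, varQ} : Set RatCXQ)) ∧
        (∀ i : ℕ, degBound m n < (i : ℤ) → (P01 m n varC varQ).coeff i = 0) := by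
  refine ⟨fun m n => ?_, fun U V hUV m n => ?_⟩
  · obtain ⟨U, V, h⟩ := exists_genRel m n
    refine ⟨(U, V), genRel_iff.1 h, fun UV hUV => ?_⟩
    obtain ⟨h1, h2⟩ := (genRel_iff.2 hUV).unique h
    exact Prod.ext h1 h2
  have hrel := fun m n => genRel_iff.2 (hUV m n)
  obtain ⟨hU, hV⟩ := isContig_of_genRel hrel
  obtain ⟨U0, V0⟩ := (hrel 0 0).unique GenRel.base_zero
  obtain ⟨U1, V1⟩ := (hrel 1 1).unique GenRel.base_one
  have hg := generic_var
  have hx := varX_ne_zero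
  have hne := varC_mul_sub_ne_zero
  refine ⟨?_, ?_, fun i => ?_, fun i hi => ?_⟩
  · refine hV.ext (isContig_shift hU _) hg.one_sub_ne hg.q_ne hx hne ?_ ?_ m n
    -- At (0,0) the formula for V needs U(-1,-1), which the relations at (-1,-1) and (0,-1) give
    -- from U(0,0) = 0 and U(1,1) = 1.
    · have e1 := hU.eq_sub (-1) (-1)
      have e2 := hU.sub_eq 0 (-1)
      rw [show (-1 : ℤ) + 1 = 0 by ring, U0] at e1 e2
      rw [zpow_zero, zero_add, show (-1 : ℤ) + 2 = 1 by ring, U1] at e2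
      have e3 : (1 - varC) * (1 - varC * varQ ^ (-1 : ℤ)) * U (-1) (-1) = varX * varQ ^ (-1 : ℤ) := by
        linear_combination (1 - varC) * e1 + e2
      have e4 := congrArg shift e3
      simp only [map_mul, map_sub, map_one, map_zpow₀, shift_varC, shift_varX, shift_varQ] at e4
      have hqi : varQ * varQ ^ (-1 : ℤ) = 1 := by
        rw [zpow_neg_one, mul_inv_cancel₀ hg.q_ne]
      rw [mul_assoc varC, mul_assoc varX, hqi, mul_one, mul_one] at e4
      rw [V0, zero_sub, div_mul_eq_mul_div, eq_div_iff hx]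
      linear_combination -e4
    · rw [V1, sub_self, U0, map_zero, mul_zero]
  · exact hU.ext (isContig_closedU hg hx hne) hg.one_sub_ne hg.q_ne hx hne
      (by rw [U0, closedU_zero hg hx hne]) (by rw [U1, closedU_one hg hx hne]) m n
  · refine coeff_P01_mem m n varC varQ
      (IntermediateField.adjoin ℂ ({varC, varQ} : Set RatCXQ)).toSubfield ?_ ?_ i
    · exact IntermediateField.subset_adjoin ℂ _ (by simp)
    · exact IntermediateField.subset_adjoin ℂ _ (by simp)
  · rw [coeff_P01, if_neg (by omega)]
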